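/- Let $\alpha>0$. There is an order of smoothness $m\in\mathbb{N}$, depending only on $\alpha$, such that the following holds for every $\xi\in[-1,1]$ and every function $g$ that is $m$ times continuously differentiable on $[-1,1]$. Put $f(x)=|x-\xi|^{\alpha}g(x)$ for $x\in[-1,1]$, where $\alpha$ is not an even integer if $\xi\in(-1,1)$, and $\alpha$ is not an integer if $\xi=\pm1$. For $n\ge 1$ let $p_n^{\mathrm I}$ and $p_n^{\mathrm{II}}$ be the unique polynomials of degree at most $n$ that interpolate $f$ at the Chebyshev points of the first kind $x_j=\cos\big((j+\tfrac12)\pi/(n+1)\big)$, $0\le j\le n$, and at the Chebyshev points of the second kind $x_j=\cos(j\pi/n)$, $0\le j\le n$, respectively. Let $\epsilon>0$. (i) If $\xi\in(-1,1)$ then, for $p_n=p_n^{\mathrm I}$ and for $p_n=p_n^{\mathrm{II}}$, and for every $x\in[-1,1]$ that is not one of the corresponding interpolation points $x_0,\dots,x_n$, $$|f(x)-p_n(x)|=\begin{cases}O(n^{-\alpha}), & |x-\xi|<\epsilon,\\ O(n^{-\alpha-1}), & \text{otherwise.}\end{cases}$$ (ii) If $\xi=\pm1$ then, for every $x\in[-1,1]$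 that is not one of the corresponding interpolation points, $$|f(x)-p_n^{\mathrm I}(x)|=\begin{cases}O(n^{-2\alpha}), & |x-\xi|<\epsilon,\\ O(n^{-2\alpha-1}), & \text{otherwise,}\end{cases}\qquad |f(x)-p_n^{\mathrm{II}}(x)|=\begin{cases}O(n^{-2\alpha}), & |x-\xi|<\epsilon\text{ and }x\ne\xi,\\ O(n^{-2\alpha-1}), & \text{otherwise.}\end{cases}$$ The constants implied by the $O$-symbols may depend on $\alpha,\xi,g,\epsilon$, but not on $n\ge1$ or on $x$. -/

import Mathlib

open Set

/-- The model function `f(x) = |x - ξ|^α g(x)`. -/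
noncomputable def modelFun (α ξ : ℝ) (g : ℝ → ℝ) (x : ℝ) : ℝ :=
  |x - ξ| ^ α * g x

/-- The `n + 1` Chebyshev points of the first kind, `x_j = cos((j + 1/2)π/(n + 1))`,
`0 ≤ j ≤ n`. -/
noncomputable def chebPointI (n j : ℕ) : ℝ :=
  Real.cos (((j : ℝ) + 1 / 2) * Real.pi / ((n : ℝ) + 1))

/-- The unique polynomial of degree at most `n` that interpolates `f` at the Chebyshev points
of the first kind. -/
noncomputable def chebInterpI (f : ℝ → ℝ) (n : ℕ) : Polynomial ℝ :=
  Lagrange.interpolate (Finset.range (n + 1)) (chebPointI n) (fun j => f (chebPointI n j))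

/-- The unique polynomial of degree at most `n` that interpolates `f` at the `n + 1` Chebyshev
points of the second kind `Polynomial.Chebyshev.node n j = cos(jπ/n)`, `0 ≤ j ≤ n`
(used for `n ≥ 1`). -/
noncomputable def chebInterpII (f : ℝ → ℝ) (n : ℕ) : Polynomial ℝ :=
  Lagrange.interpolate (Finset.range (n + 1)) (Polynomial.Chebyshev.node n)
    (fun j => f (Polynomial.Chebyshev.node n j))

/-! With `x = cos θ`, `f` becomes an even periodic function `|s|^γ q` with `s` smooth and having
simple zeros. For interior `ξ`, `s = cos θ - ξ` and `γ = α`; at an endpoint `x - ξ` has a double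
zero in `θ`, so `s` is a half-angle sine or cosine and `γ = 2α`.

Chebyshev coefficients. Differencing `r` times with step `π/|k|` bounds the `k`-th coefficient by
the mean size of the differences, giving `O(|k|^(-γ-1))`; multiplying `f` by `x - ξ` gains one power
(`exists_norm_fourier_integral_le`).

Interpolation. On the nodes `T_k` equals `σ T_{k₀}` with `|σ| ≤ 1` and `|k₀| ≤ n`, so the
interpolation operator `P` maps each `T_k` to a function bounded by 1 and fixes those with `|k| ≤
n`. Summing the tail gives `O(n^(-γ))`. Away from `ξ`, write `(x-ξ)(f-Pf) = [(x-ξ)f - P((x-ξ)f)] -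
[(x-ξ)Pf - P((x-ξ)f)]`. The first bracket is a tail with the better coefficients. The second, a
commutator, only sees `k ≡ ±n` modulo `2N` (`commutator_T`); this sparse sum is as small as its
first term, `O(n^(-γ-1))`. Dividing by `|x-ξ| ≥ ε` finishes. -/

/-! ### Iterated differences near and away from an algebraic singularity -/

theorem fwdDiff_iter_abs_le (r : ℕ) : ∀ (F : ℝ → ℝ) {θ h M : ℝ}, 0 ≤ h →
    (∀ t ∈ Icc θ (θ + r * h), |F t| ≤ M) → |(fwdDiff h)^[r] F θ| ≤ 2 ^ r * M := by
  induction r with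
  | zero => intro F θ h M hh H; simpa using H θ (by simp)
  | succ r ih =>
    intro F θ h M hh H
    rw [Function.iterate_succ_apply]
    have := ih (fwdDiff h F) (θ := θ) (M := 2 * M) hh (fun t ht => by
      push_cast at H
      have h1 := H t ⟨ht.1, by nlinarith [ht.2]⟩
      have h2 := H (t + h) ⟨by linarith [ht.1], by nlinarith [ht.2]⟩
      rw [fwdDiff]
      linarith [abs_sub (F (t + h)) (F t)])
    rw [pow_succ]; linarith

/-- Differencing the whole chain `Φ` preserves the derivative relations, and the mean value
inequality turns the bound `M` at the top into `h * M` one level lower. -/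
theorem fwdDiff_iter_abs_le_of_hasDerivAt (r : ℕ) : ∀ (Φ : ℕ → ℝ → ℝ) {θ h M : ℝ}, 0 ≤ h →
    (∀ i < r, ∀ t ∈ Icc θ (θ + r * h), HasDerivAt (Φ i) (Φ (i + 1) t) t) →
    (∀ t ∈ Icc θ (θ + r * h), |Φ r t| ≤ M) → |(fwdDiff h)^[r] (Φ 0) θ| ≤ h ^ r * M := by
  induction r with
  | zero => intro Φ θ h M hh _ H; simpa using H θ (by simp)
  | succ r ih =>
    intro Φ θ h M hh hd H
    rw [Function.iterate_succ_apply]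
    push_cast at hd H
    have key := ih (fun i => fwdDiff h (Φ i)) (θ := θ) (M := h * M) hh
      (fun i hi t ht => by
        have h1 := hd i (by omega) t ⟨ht.1, by nlinarith [ht.2]⟩
        have h2 := hd i (by omega) (t + h) ⟨by linarith [ht.1], by nlinarith [ht.2]⟩
        exact (h2.comp_add_const t h).sub h1)
      (fun t ht => by
        have hsub : Icc t (t + h) ⊆ Icc θ (θ + (r + 1) * h) :=
          Icc_subset_Icc ht.1 (by nlinarith [ht.2])
        have := (convex_Icc t (t + h)).norm_image_sub_le_of_norm_hasDerivWithin_le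
          (f := Φ r) (f' := Φ (r + 1)) (C := M)
          (fun y hy => (hd r (by omega) y (hsub hy)).hasDerivWithinAt)
          (fun y hy => H y (hsub hy)) (left_mem_Icc.2 (by linarith))
          (right_mem_Icc.2 (by linarith))
        rw [add_sub_cancel_left, Real.norm_eq_abs, Real.norm_eq_abs, abs_of_nonneg hh] at this
        simpa [fwdDiff, mul_comm] using this)
    rw [pow_succ, mul_assoc]; exact key

/-- The smooth factor in the `j`-th derivative of `|s| ^ γ * s ^ i * q`, where `δ = γ + i`. -/
noncomputable def derivFactor (δ : ℝ) (s q : ℝ → ℝ) : ℕ → ℝ → ℝ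
  | 0 => q
  | j + 1 => fun t =>
      (δ - j) * deriv s t * derivFactor δ s q j t + s t * deriv (derivFactor δ s q j) t

theorem contDiff_derivFactor {δ : ℝ} {s q : ℝ → ℝ} {r : ℕ} (hs : ∀ n : ℕ, ContDiff ℝ n s)
    (hq : ContDiff ℝ r q) : ∀ j ≤ r, ContDiff ℝ (r - j : ℕ) (derivFactor δ s q j) := by
  intro j
  induction j with
  | zero => intro _; simpa [derivFactor] using hq
  | succ j ih =>
    intro hj
    have h1 := ih (by omega)
    have e : r - j = (r - (j + 1)) + 1 := by omega
    have hle : ((r - (j + 1) : ℕ) : WithTop ℕ∞) ≤ ((r - j : ℕ) : WithTop ℕ∞) := by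
      exact_mod_cast (by omega : r - (j + 1) ≤ r - j)
    have h2 : ContDiff ℝ (r - (j + 1) : ℕ) (deriv (derivFactor δ s q j)) := by
      rw [e] at h1; push_cast at h1
      exact (contDiff_succ_iff_deriv.1 h1).2.2
    have h3 : ContDiff ℝ (r - (j + 1) : ℕ) (deriv s) := by
      have := hs (r - (j + 1) + 1); push_cast at this
      exact (contDiff_succ_iff_deriv.1 this).2.2
    exact ((contDiff_const.mul h3).mul (h1.of_le hle)).add ((hs _).mul h2)

/-- Keeping the sign of `s` in an integer power means that differentiation lowers only `k`, while
`|s| ^ γ` stays as it is. -/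
theorem hasDerivAt_abs_rpow_mul_zpow {s : ℝ → ℝ} {s' t : ℝ} (hs : HasDerivAt s s' t)
    (h0 : s t ≠ 0) (γ : ℝ) (k : ℤ) :
    HasDerivAt (fun t => |s t| ^ γ * s t ^ k) (|s t| ^ γ * s t ^ (k - 1) * ((γ + k) * s')) t := by
  have h1 : HasDerivAt (fun t => |s t| ^ γ) (|s t| ^ γ * (s t)⁻¹ * (γ * s')) t := by
    have ha : HasDerivAt (fun t => |s t|) (SignType.sign (s t) * s') t :=
      (hasDerivAt_abs h0).comp t hs
    have := ha.rpow_const (p := γ) (Or.inl (abs_ne_zero.2 h0))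
    convert this using 1
    rw [Real.rpow_sub_one (abs_ne_zero.2 h0)]
    rcases lt_or_gt_of_ne h0 with h | h
    · simp only [abs_of_neg h, sign_neg h]; field_simp; simp
    · simp only [abs_of_pos h, sign_pos h]; field_simp; simp
  have h2 : HasDerivAt (fun t => s t ^ k) (k * s t ^ (k - 1) * s') t :=
    (hasDerivAt_zpow k (s t) (Or.inl h0)).comp t hs
  refine (h1.mul h2).congr_deriv ?_
  rw [zpow_sub_one₀ h0]; ring

theorem hasDerivAt_derivFactor {γ : ℝ} {i r : ℕ} {s q : ℝ → ℝ} (hs : ∀ n : ℕ, ContDiff ℝ n s)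
    (hq : ContDiff ℝ r q) {j : ℕ} (hj : j < r) {t : ℝ} (h0 : s t ≠ 0) :
    HasDerivAt (fun t => |s t| ^ γ * s t ^ ((i : ℤ) - j) * derivFactor (γ + i) s q j t)
      (|s t| ^ γ * s t ^ ((i : ℤ) - (j + 1 : ℕ)) * derivFactor (γ + i) s q (j + 1) t) t := by
  have hst : HasDerivAt s (deriv s t) t :=
    ((hs 1).differentiable (by simp) t).hasDerivAt
  have hqj : HasDerivAt (derivFactor (γ + i) s q j) (deriv (derivFactor (γ + i) s q j) t) t :=
    ((contDiff_derivFactor hs hq j hj.le).differentiable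
      (by exact_mod_cast (by omega : r - j ≠ 0)) t).hasDerivAt
  refine ((hasDerivAt_abs_rpow_mul_zpow hst h0 γ ((i : ℤ) - j)).mul hqj).congr_deriv ?_
  have e : (i : ℤ) - (j + 1 : ℕ) = (i - j : ℤ) - 1 := by push_cast; ring
  rw [e, derivFactor, zpow_sub_one₀ h0]
  push_cast
  field_simp
  ring

theorem abs_rpow_mul_zpow {x : ℝ} (hx : x ≠ 0) (γ : ℝ) (k : ℤ) :
    |(|x| ^ γ * x ^ k)| = |x| ^ (γ + k) := by
  rw [abs_mul, abs_zpow, abs_of_nonneg (Real.rpow_nonneg (abs_nonneg x) γ),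
    Real.rpow_add_intCast (abs_ne_zero.2 hx)]

theorem abs_rpow_mul_pow {γ : ℝ} (hγ : 0 < γ) (x : ℝ) (i : ℕ) :
    |(|x| ^ γ * x ^ i)| = |x| ^ (γ + i) := by
  rcases eq_or_ne x 0 with rfl | hx
  · rw [abs_zero, Real.zero_rpow hγ.ne', Real.zero_rpow (by positivity)]; simp
  · simpa using abs_rpow_mul_zpow hx γ i

theorem exists_abs_le_on_Icc {u : ℝ → ℝ} (hu : Continuous u) (b : ℝ) :
    ∃ Q : ℝ, 0 ≤ Q ∧ ∀ t ∈ Icc (0 : ℝ) b, |u t| ≤ Q := by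
  obtain ⟨Q, hQ⟩ := (isCompact_Icc (a := (0 : ℝ)) (b := b)).exists_bound_of_continuousOn
    hu.continuousOn
  exact ⟨max Q 0, le_max_right _ _, fun t ht => (hQ t ht).trans (le_max_left _ _)⟩

/-- Where `|s| ≥ 2 r h`, the `r`-th difference is controlled by the `r`-th derivative. -/
theorem abs_fwdDiff_iter_le_far {γ : ℝ} {i r : ℕ} {s q : ℝ → ℝ}
    (hr1 : 1 ≤ r) (hr : γ + i + 2 ≤ r) (hs : ∀ n : ℕ, ContDiff ℝ n s)
    (hq : ContDiff ℝ r q) (hlip : ∀ x y, |s x - s y| ≤ |x - y|) {Q h θ : ℝ} (hh : 0 < h)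
    (hQ : ∀ t ∈ Icc θ (θ + r * h), |derivFactor (γ + i) s q r t| ≤ Q)
    (hfar : 2 * r * h ≤ |s θ|) :
    |(fwdDiff h)^[r] (fun t => |s t| ^ γ * s t ^ i * q t) θ| ≤
      2 * 2 ^ ((r : ℝ) - (γ + i)) * Q * (h ^ (γ + i) * (h ^ 2 / (h ^ 2 + s θ ^ 2))) := by
  set δ := γ + i with hδ
  have hr1' : (1 : ℝ) ≤ r := by exact_mod_cast hr1
  have hsθ : 0 < |s θ| := by nlinarith
  have hhs : h ≤ |s θ| := by nlinarith
  have hQ0 : 0 ≤ Q := (abs_nonneg _).trans (hQ θ ⟨le_rfl, by nlinarith⟩)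
  -- `s` is 1-Lipschitz and moves by at most `r * h ≤ |s θ| / 2` over the stencil, which therefore
  -- avoids its zeros.
  have hhalf : ∀ t ∈ Icc θ (θ + r * h), |s θ| / 2 ≤ |s t| := fun t ht => by
    have h1 := hlip θ t
    have h2 := abs_sub_abs_le_abs_sub (s θ) (s t)
    have h3 : |θ - t| ≤ r * h := by rw [abs_le]; constructor <;> linarith [ht.1, ht.2]
    linarith
  have hne : ∀ t ∈ Icc θ (θ + r * h), s t ≠ 0 := fun t ht =>
    abs_pos.1 (by linarith [hhalf t ht])
  have key := fwdDiff_iter_abs_le_of_hasDerivAt r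
    (fun j t => |s t| ^ γ * s t ^ ((i : ℤ) - j) * derivFactor δ s q j t)
    (θ := θ) (h := h) (M := (|s θ| / 2) ^ (δ - r) * Q) hh.le
    (fun j hj t ht => hasDerivAt_derivFactor hs hq hj (hne t ht))
    (fun t ht => by
      rw [abs_mul, abs_rpow_mul_zpow (hne t ht)]
      have e : γ + ((i : ℤ) - (r : ℕ) : ℤ) = δ - r := by push_cast; ring
      rw [e]
      exact mul_le_mul (Real.rpow_le_rpow_of_nonpos (by linarith) (hhalf t ht) (by linarith))
        (hQ t ht) (abs_nonneg _) (by positivity))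
  have e0 : (fun t => |s t| ^ γ * s t ^ ((i : ℤ) - (0 : ℕ)) * derivFactor δ s q 0 t)
      = fun t => |s t| ^ γ * s t ^ i * q t := by
    funext t; simp [derivFactor]
  simp only [e0] at key
  refine key.trans ?_
  have e1 : h ^ r * ((|s θ| / 2) ^ (δ - r) * Q)
      = 2 ^ ((r : ℝ) - δ) * Q * (h ^ δ * (h / |s θ|) ^ ((r : ℝ) - δ)) := by
    rw [Real.div_rpow hh.le hsθ.le, Real.div_rpow hsθ.le (by norm_num),
      Real.rpow_sub hh, Real.rpow_natCast, ← neg_sub (r : ℝ) δ, Real.rpow_neg hsθ.le,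
      Real.rpow_neg (by norm_num)]
    have := Real.rpow_pos_of_pos hh δ
    field_simp
  -- Since `r - δ ≥ 2`, the decay is at least quadratic, which is all that integrability needs.
  have e2 : (h / |s θ|) ^ ((r : ℝ) - δ) ≤ 2 * (h ^ 2 / (h ^ 2 + s θ ^ 2)) := by
    calc (h / |s θ|) ^ ((r : ℝ) - δ) ≤ (h / |s θ|) ^ (2 : ℝ) :=
          Real.rpow_le_rpow_of_exponent_ge (by positivity) ((div_le_one hsθ).2 hhs) (by linarith)
      _ = h ^ 2 / s θ ^ 2 := by rw [Real.rpow_two, div_pow, sq_abs]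
      _ ≤ 2 * (h ^ 2 / (h ^ 2 + s θ ^ 2)) := by
          have h2 : h ^ 2 ≤ s θ ^ 2 := by rw [← sq_abs (s θ)]; gcongr
          have h3 : 0 < s θ ^ 2 := by rw [← sq_abs (s θ)]; positivity
          rw [← mul_div_assoc, div_le_div_iff₀ h3 (by positivity)]
          nlinarith [sq_nonneg h]
  rw [e1]
  calc 2 ^ ((r : ℝ) - δ) * Q * (h ^ δ * (h / |s θ|) ^ ((r : ℝ) - δ))
      ≤ 2 ^ ((r : ℝ) - δ) * Q * (h ^ δ * (2 * (h ^ 2 / (h ^ 2 + s θ ^ 2)))) := by gcongr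
    _ = _ := by ring

/-- Where `|s| ≤ 2 r h`, the `r`-th difference is controlled by the size of the function. -/
theorem abs_fwdDiff_iter_le_near {γ : ℝ} (hγ : 0 < γ) {i r : ℕ} {s q : ℝ → ℝ}
    (hlip : ∀ x y, |s x - s y| ≤ |x - y|) {Q h θ : ℝ} (hh : 0 < h)
    (hQ : ∀ t ∈ Icc θ (θ + r * h), |q t| ≤ Q) (hnear : |s θ| ≤ 2 * r * h) :
    |(fwdDiff h)^[r] (fun t => |s t| ^ γ * s t ^ i * q t) θ| ≤
      2 ^ r * (3 * r) ^ (γ + i) * Q * (1 + 4 * r ^ 2) *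
        (h ^ (γ + i) * (h ^ 2 / (h ^ 2 + s θ ^ 2))) := by
  have hQ0 : 0 ≤ Q := (abs_nonneg _).trans (hQ θ ⟨le_rfl, by simp; positivity⟩)
  have key := fwdDiff_iter_abs_le r (fun t => |s t| ^ γ * s t ^ i * q t) (θ := θ) (h := h)
    (M := (3 * r * h) ^ (γ + i) * Q) hh.le (fun t ht => by
      rw [abs_mul, abs_rpow_mul_pow hγ]
      have h1 := hlip t θ
      have h2 := abs_sub_abs_le_abs_sub (s t) (s θ)
      have h3 : |t - θ| ≤ r * h := by rw [abs_le]; constructor <;> linarith [ht.1, ht.2]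
      have h4 : |s t| ≤ 3 * r * h := by linarith
      have := hQ t ht
      gcongr)
  refine key.trans ?_
  -- Near a zero the kernel is bounded below, so it can be inserted at the cost of a constant.
  have h1 : 1 ≤ (1 + 4 * (r : ℝ) ^ 2) * (h ^ 2 / (h ^ 2 + s θ ^ 2)) := by
    rw [← mul_div_assoc, one_le_div (by positivity), ← sq_abs (s θ)]
    nlinarith [pow_le_pow_left₀ (abs_nonneg (s θ)) hnear 2]
  rw [Real.mul_rpow (by positivity) hh.le]
  calc 2 ^ r * ((3 * (r : ℝ)) ^ (γ + i) * h ^ (γ + i) * Q)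
      ≤ 2 ^ r * ((3 * (r : ℝ)) ^ (γ + i) * h ^ (γ + i) * Q) *
        ((1 + 4 * (r : ℝ) ^ 2) * (h ^ 2 / (h ^ 2 + s θ ^ 2))) :=
          le_mul_of_one_le_right (by positivity) h1
    _ = _ := by ring

theorem exists_abs_fwdDiff_iter_le {γ : ℝ} (hγ : 0 < γ) {i r : ℕ} {s q : ℝ → ℝ}
    (hr : γ + i + 2 ≤ r) (hs : ∀ n : ℕ, ContDiff ℝ n s)
    (hq : ContDiff ℝ r q) (hlip : ∀ x y, |s x - s y| ≤ |x - y|) (b H : ℝ) :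
    ∃ C : ℝ, 0 ≤ C ∧ ∀ h : ℝ, 0 < h → h ≤ H → ∀ θ ∈ Icc (0 : ℝ) b,
      |(fwdDiff h)^[r] (fun t => |s t| ^ γ * s t ^ i * q t) θ| ≤
        C * (h ^ (γ + i) * (h ^ 2 / (h ^ 2 + s θ ^ 2))) := by
  have hr1 : 1 ≤ r := by
    have : (1 : ℝ) ≤ r := by linarith [(Nat.cast_nonneg i : (0 : ℝ) ≤ i)]
    exact_mod_cast this
  obtain ⟨Q0, hQ0, hb0⟩ := exists_abs_le_on_Icc hq.continuous (b + r * H)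
  obtain ⟨Q1, hQ1, hb1⟩ := exists_abs_le_on_Icc
    (contDiff_derivFactor (δ := γ + i) hs hq r le_rfl).continuous (b + r * H)
  refine ⟨2 * 2 ^ ((r : ℝ) - (γ + i)) * Q1 + 2 ^ r * (3 * r) ^ (γ + i) * Q0 * (1 + 4 * r ^ 2),
    by positivity, fun h hh hH θ hθ => ?_⟩
  have hsub : Icc θ (θ + r * h) ⊆ Icc 0 (b + r * H) :=
    Icc_subset_Icc hθ.1 (by gcongr; exact hθ.2)
  rw [add_mul]
  have p1 : 0 ≤ 2 * 2 ^ ((r : ℝ) - (γ + i)) * Q1 * (h ^ (γ + i) * (h ^ 2 / (h ^ 2 + s θ ^ 2))) := by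
    positivity
  have p2 : 0 ≤ 2 ^ r * (3 * r) ^ (γ + i) * Q0 * (1 + 4 * r ^ 2) *
      (h ^ (γ + i) * (h ^ 2 / (h ^ 2 + s θ ^ 2))) := by
    positivity
  rcases le_total (2 * r * h) |s θ| with hc | hc
  · linarith [abs_fwdDiff_iter_le_far hr1 hr hs hq hlip hh (fun t ht => hb1 t (hsub ht)) hc]
  · linarith [abs_fwdDiff_iter_le_near (i := i) hγ hlip hh (fun t ht => hb0 t (hsub ht)) hc]

/-! ### Decay of Fourier coefficients -/

/-- The kernel is dominated by two Cauchy densities of width `h / c` centred at the zeros `a` and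
`a'`, each of total mass `π h / c`. -/
theorem integral_sq_div_add_sq_le {s : ℝ → ℝ} (hs : Continuous s) {c a a' b : ℝ} (hc : 0 < c)
    (hb : 0 ≤ b)
    (hlow : ∀ t ∈ Icc (0 : ℝ) b, c * |t - a| ≤ |s t| ∨ c * |t - a'| ≤ |s t|) {h : ℝ} (hh : 0 < h) :
    ∫ t in (0 : ℝ)..b, h ^ 2 / (h ^ 2 + s t ^ 2) ≤ 2 * Real.pi / c * h := by
  set G : ℝ → ℝ → ℝ := fun a t => (1 + (c / h * (t - a)) ^ 2)⁻¹ with hG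
  have hint : ∀ a, MeasureTheory.Integrable (G a) := fun a =>
    (integrable_inv_one_add_sq.comp_mul_left' (by positivity : c / h ≠ 0)).comp_sub_right a
  have hval : ∀ a, ∫ t, G a t = Real.pi / c * h := fun a => by
    simp only [hG]
    rw [MeasureTheory.integral_sub_right_eq_self (fun t => (1 + (c / h * t) ^ 2)⁻¹) a,
      MeasureTheory.Measure.integral_comp_mul_left (fun t => (1 + t ^ 2)⁻¹) (c / h),
      integral_univ_inv_one_add_sq, abs_of_pos (by positivity)]
    simp; field_simp
  have hle : ∀ a, ∫ t in (0 : ℝ)..b, G a t ≤ Real.pi / c * h := fun a => by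
    rw [← hval a, intervalIntegral.integral_of_le hb]
    exact MeasureTheory.setIntegral_le_integral (hint a)
      (Filter.Eventually.of_forall fun t => by simp only [hG, Pi.zero_apply]; positivity)
  have hpt : ∀ a t, c * |t - a| ≤ |s t| → h ^ 2 / (h ^ 2 + s t ^ 2) ≤ G a t := fun a t H => by
    have h1 := pow_le_pow_left₀ (by positivity) H 2
    rw [sq_abs, mul_pow, sq_abs] at h1
    have e : G a t = h ^ 2 / (h ^ 2 + c ^ 2 * (t - a) ^ 2) := by
      simp only [hG]; field_simp
    rw [e]; gcongr
  have hpos : ∀ a t, 0 ≤ G a t := fun a t => by simp only [hG]; positivity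
  have hii : ∀ a, IntervalIntegrable (G a) MeasureTheory.volume 0 b := fun a =>
    (hint a).intervalIntegrable
  calc ∫ t in (0 : ℝ)..b, h ^ 2 / (h ^ 2 + s t ^ 2) ≤ ∫ t in (0 : ℝ)..b, (G a t + G a' t) := by
        refine intervalIntegral.integral_mono_on hb ?_ ((hii a).add (hii a')) fun t ht => ?_
        · exact (continuous_const.div (by fun_prop) fun t => by positivity).intervalIntegrable _ _
        · rcases hlow t ht with H | H
          · linarith [hpt a t H, hpos a' t]
          · linarith [hpt a' t H, hpos a t]
    _ ≤ 2 * Real.pi / c * h := by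
        rw [intervalIntegral.integral_add (hii a) (hii a')]
        have h1 := hle a
        have h2 := hle a'
        have : 2 * Real.pi / c * h = Real.pi / c * h + Real.pi / c * h := by ring
        linarith

/-- A shift by `h` flips the sign of the `k`-th exponential, so both terms of the difference
contribute the same integral. -/
theorem integral_exp_mul_fwdDiff {F : ℝ → ℝ} (hc : Continuous F)
    (hp : Function.Periodic F (2 * Real.pi)) {k : ℤ} {h : ℝ}
    (hk : Complex.exp (Complex.I * k * h) = -1) :
    ∫ t in (0 : ℝ)..2 * Real.pi, Complex.exp (-(Complex.I * k * t)) * (fwdDiff h F t : ℝ) =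
      -2 * ∫ t in (0 : ℝ)..2 * Real.pi, Complex.exp (-(Complex.I * k * t)) * (F t : ℂ) := by
  set E : ℝ → ℂ := fun t => Complex.exp (-(Complex.I * k * t)) * (F t : ℂ) with hE
  have hEc : Continuous E := by simp only [hE]; fun_prop
  have hEp : Function.Periodic E (2 * Real.pi) := fun t => by
    simp only [hE, hp t]
    congr 1
    rw [Complex.exp_eq_exp_iff_exists_int]
    exact ⟨-k, by push_cast; ring⟩
  have e : ∀ t : ℝ, Complex.exp (-(Complex.I * k * t)) * (fwdDiff h F t : ℝ)
      = -E (t + h) - E t := fun t => by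
    have : Complex.exp (-(Complex.I * k * t))
        = -Complex.exp (-(Complex.I * k * (t + h : ℝ))) := by
      have : -(Complex.I * k * t) = Complex.I * k * h + -(Complex.I * k * (t + h : ℝ)) := by
        push_cast; ring
      rw [this, Complex.exp_add, hk]; ring
    simp only [hE, fwdDiff]
    rw [Complex.ofReal_sub, mul_sub]
    nth_rewrite 1 [this]
    ring
  have hshift : ∫ t in (0 : ℝ)..2 * Real.pi, E (t + h) = ∫ t in (0 : ℝ)..2 * Real.pi, E t := by
    rw [intervalIntegral.integral_comp_add_right (fun t => E t) h]
    have := hEp.intervalIntegral_add_eq h 0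
    simpa [add_comm] using this
  simp_rw [e]
  have hi1 : IntervalIntegrable (fun t => -E (t + h)) MeasureTheory.volume 0 (2 * Real.pi) :=
    (by fun_prop : Continuous fun t => -E (t + h)).intervalIntegrable _ _
  rw [intervalIntegral.integral_sub hi1 (hEc.intervalIntegrable _ _),
    intervalIntegral.integral_neg, hshift]
  ring

/-- Each difference doubles the coefficient in modulus; the resulting gain `2 ^ r` is discarded. -/
theorem norm_integral_exp_mul_le (r : ℕ) : ∀ {F : ℝ → ℝ}, Continuous F →
    Function.Periodic F (2 * Real.pi) → ∀ {k : ℤ} {h : ℝ},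
    Complex.exp (Complex.I * k * h) = -1 →
    ‖∫ t in (0 : ℝ)..2 * Real.pi, Complex.exp (-(Complex.I * k * t)) * (F t : ℂ)‖ ≤
      ∫ t in (0 : ℝ)..2 * Real.pi, |(fwdDiff h)^[r] F t| := by
  induction r with
  | zero =>
    intro F _ _ k h _
    refine (intervalIntegral.norm_integral_le_integral_norm (by positivity)).trans_eq ?_
    congr 1; funext t
    have : -(Complex.I * k * t) = ((-(k * t) : ℝ) : ℂ) * Complex.I := by push_cast; ring
    rw [norm_mul, this, Complex.norm_exp_ofReal_mul_I, one_mul, Complex.norm_real]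
    rfl
  | succ r ih =>
    intro F hc hp k h hk
    have hc' : Continuous (fwdDiff h F) := by unfold fwdDiff; fun_prop
    have hp' : Function.Periodic (fwdDiff h F) (2 * Real.pi) := fun t => by
      simp only [fwdDiff]
      rw [add_right_comm, hp, hp]
    have := ih hc' hp' hk
    rw [integral_exp_mul_fwdDiff hc hp hk, norm_mul] at this
    rw [Function.iterate_succ_apply]
    norm_num at this
    linarith [norm_nonneg (∫ t in (0 : ℝ)..2 * Real.pi,
      Complex.exp (-(Complex.I * k * t)) * (F t : ℂ))]

theorem continuous_fwdDiff_iter (r : ℕ) (h : ℝ) : ∀ {F : ℝ → ℝ}, Continuous F →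
    Continuous ((fwdDiff h)^[r] F) := by
  induction r with
  | zero => intro F hF; exact hF
  | succ r ih =>
    intro F hF
    rw [Function.iterate_succ_apply]
    exact ih (by unfold fwdDiff; fun_prop)

/-- With `h = π / |k|` the differences contribute `h ^ (γ + i)`, and integrating the kernel
contributes one further factor `h`. -/
theorem exists_norm_fourier_integral_le {γ : ℝ} (hγ : 0 < γ) {i r : ℕ} {s q : ℝ → ℝ}
    (hr : γ + i + 2 ≤ r) (hs : ∀ n : ℕ, ContDiff ℝ n s)
    (hq : ContDiff ℝ r q) (hlip : ∀ x y, |s x - s y| ≤ |x - y|) {c a a' : ℝ} (hc : 0 < c)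
    (hlow : ∀ t ∈ Icc (0 : ℝ) (2 * Real.pi), c * |t - a| ≤ |s t| ∨ c * |t - a'| ≤ |s t|)
    (hp : Function.Periodic (fun t => |s t| ^ γ * s t ^ i * q t) (2 * Real.pi)) :
    ∃ C : ℝ, 0 ≤ C ∧ ∀ k : ℤ, k ≠ 0 →
      ‖∫ t in (0 : ℝ)..2 * Real.pi,
        Complex.exp (-(Complex.I * k * t)) * ((|s t| ^ γ * s t ^ i * q t : ℝ) : ℂ)‖ ≤
        C * |(k : ℝ)| ^ (-(γ + i) - 1) := by
  obtain ⟨C, hC0, hC⟩ := exists_abs_fwdDiff_iter_le hγ hr hs hq hlip (2 * Real.pi) Real.pi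
  have hsc : Continuous s := (hs 0).continuous
  have hF : Continuous (fun t => |s t| ^ γ * s t ^ i * q t) :=
    ((hsc.abs.rpow_const fun _ => Or.inr hγ.le).mul (hsc.pow i)).mul hq.continuous
  have hpi := Real.pi_pos
  refine ⟨C * (2 * Real.pi / c) * Real.pi ^ (γ + i + 1), by positivity, fun k hk => ?_⟩
  have hk0 : 0 < |(k : ℝ)| := abs_pos.2 (Int.cast_ne_zero.2 hk)
  have hk1 : 1 ≤ |(k : ℝ)| := by exact_mod_cast Int.one_le_abs hk
  set h := Real.pi / |(k : ℝ)| with hh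
  have h0 : 0 < h := by positivity
  have hexp : Complex.exp (Complex.I * k * h) = -1 := by
    rcases abs_cases (k : ℝ) with ⟨e, _⟩ | ⟨e, _⟩
    · have : Complex.I * k * h = Real.pi * Complex.I := by
        rw [hh, e]; push_cast; field_simp
      rw [this, Complex.exp_pi_mul_I]
    · have : Complex.I * k * h = -(Real.pi * Complex.I) := by
        rw [hh, e]; push_cast; field_simp
      rw [this, Complex.exp_neg, Complex.exp_pi_mul_I]; norm_num
  refine (norm_integral_exp_mul_le r hF hp hexp).trans ?_
  calc ∫ t in (0 : ℝ)..2 * Real.pi, |(fwdDiff h)^[r] (fun t => |s t| ^ γ * s t ^ i * q t) t|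
      ≤ ∫ t in (0 : ℝ)..2 * Real.pi, C * (h ^ (γ + i) * (h ^ 2 / (h ^ 2 + s t ^ 2))) := by
        refine intervalIntegral.integral_mono_on (by positivity)
          ((continuous_fwdDiff_iter r h hF).abs.intervalIntegrable _ _) ?_
          fun t ht => hC h h0 (div_le_self hpi.le hk1) t ht
        refine Continuous.intervalIntegrable ?_ _ _
        exact continuous_const.mul (continuous_const.mul
          (continuous_const.div (by fun_prop) fun t => by positivity))
    _ = C * h ^ (γ + i) * ∫ t in (0 : ℝ)..2 * Real.pi, h ^ 2 / (h ^ 2 + s t ^ 2) := by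
        rw [intervalIntegral.integral_const_mul, intervalIntegral.integral_const_mul, mul_assoc]
    _ ≤ C * h ^ (γ + i) * (2 * Real.pi / c * h) := by
        gcongr
        exact integral_sq_div_add_sq_le hsc hc (by positivity) hlow h0
    _ = C * (2 * Real.pi / c) * h ^ (γ + i + 1) := by
        rw [Real.rpow_add_one h0.ne']; ring
    _ = C * (2 * Real.pi / c) * Real.pi ^ (γ + i + 1) * |(k : ℝ)| ^ (-(γ + i) - 1) := by
        rw [hh, Real.div_rpow hpi.le hk0.le, ← neg_add', Real.rpow_neg hk0.le]
        ring

/-! ### Cosine series, tails and sums over residue classes -/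

theorem summable_of_abs_le_rpow {E : Type*} [NormedAddCommGroup E] [CompleteSpace E]
    {u : ℤ → E} {C δ : ℝ} (hδ : 0 < δ)
    (hu : ∀ k : ℤ, k ≠ 0 → ‖u k‖ ≤ C * |(k : ℝ)| ^ (-δ - 1)) : Summable u := by
  have h1 : Summable fun k : ℤ => C * |(k : ℝ)| ^ (-δ - 1) := by
    have := (Real.summable_abs_int_rpow (b := δ + 1) (by linarith)).mul_left C
    simpa only [neg_add'] using this
  refine Summable.of_norm_bounded_eventually h1 ?_
  refine (Set.finite_singleton (0 : ℤ)).subset fun k hk => ?_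
  by_contra h0
  exact hk (hu k h0)

/-- Summable coefficients make the Fourier series converge pointwise; averaging it at `t` and `-t`
and taking real parts leaves cosines. -/
theorem exists_hasSum_cos {F : ℝ → ℝ} (hF : Continuous F)
    (hp : Function.Periodic F (2 * Real.pi)) (he : ∀ t, F (-t) = F t) {C δ : ℝ} (hδ : 0 < δ)
    (hb : ∀ k : ℤ, k ≠ 0 →
      ‖∫ t in (0 : ℝ)..2 * Real.pi, Complex.exp (-(Complex.I * k * t)) * (F t : ℂ)‖ ≤
        C * |(k : ℝ)| ^ (-δ - 1)) :
    ∃ u : ℤ → ℝ, (∀ k : ℤ, k ≠ 0 → |u k| ≤ C * |(k : ℝ)| ^ (-δ - 1)) ∧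
      ∀ t : ℝ, HasSum (fun k : ℤ => u k * Real.cos (k * t)) (F t) := by
  have hpi := Real.pi_pos
  have : Fact (0 < 2 * Real.pi) := ⟨by positivity⟩
  have hpC : Function.Periodic (fun t => (F t : ℂ)) (2 * Real.pi) := fun t => by
    simp only [hp t]
  let f : C(AddCircle (2 * Real.pi), ℂ) :=
    ⟨hpC.lift, continuous_coinduced_dom.2 (by
      change Continuous fun t => (F t : ℂ)
      fun_prop)⟩
  have hf : ∀ t : ℝ, f (t : AddCircle (2 * Real.pi)) = F t := fun t => hpC.lift_coe t
  have hexp : ∀ (k : ℤ) (t : ℝ), fourier k (t : AddCircle (2 * Real.pi))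
      = Complex.exp (Complex.I * k * t) := fun k t => by
    rw [fourier_coe_apply]
    congr 1
    push_cast
    field_simp
  have hcoef : ∀ k : ℤ, fourierCoeff f k = ((1 / (2 * Real.pi) : ℝ) : ℂ) *
      ∫ t in (0 : ℝ)..2 * Real.pi, Complex.exp (-(Complex.I * k * t)) * (F t : ℂ) := fun k => by
    rw [fourierCoeff_eq_intervalIntegral f k 0, zero_add, Complex.real_smul]
    congr 1
    refine intervalIntegral.integral_congr fun t _ => ?_
    simp only [hexp, hf, smul_eq_mul]
    push_cast
    congr 2
    ring
  have hbound : ∀ k : ℤ, k ≠ 0 → ‖fourierCoeff f k‖ ≤ C * |(k : ℝ)| ^ (-δ - 1) := fun k hk => by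
    rw [hcoef, norm_mul, Complex.norm_real, Real.norm_of_nonneg (by positivity)]
    refine (mul_le_of_le_one_left (norm_nonneg _) ?_).trans (hb k hk)
    rw [div_le_one (by positivity)]
    linarith [Real.pi_gt_three]
  have hsum := has_pointwise_sum_fourier_series_of_summable (summable_of_abs_le_rpow hδ hbound)
  refine ⟨fun k => (fourierCoeff f k).re, fun k hk =>
    (Complex.abs_re_le_norm _).trans (hbound k hk), fun t => ?_⟩
  have h1 := hsum (t : AddCircle (2 * Real.pi))
  have h2 := hsum ((-t : ℝ) : AddCircle (2 * Real.pi))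
  rw [hf] at h1 h2
  rw [he] at h2
  have h3 := Complex.hasSum_re ((h1.add h2).mul_left (1 / 2 : ℂ))
  have e1 : ((1 / 2 : ℂ) * ((F t : ℂ) + F t)).re = F t := by
    rw [← two_mul, ← mul_assoc]; norm_num
  rw [e1] at h3
  refine h3.congr_fun ?_
  intro k
  rw [hexp, hexp]
  have e2 : (1 / 2 : ℂ) * (fourierCoeff f k • Complex.exp (Complex.I * k * t) +
      fourierCoeff f k • Complex.exp (Complex.I * k * (-t : ℝ)))
      = fourierCoeff f k * (Real.cos (k * t) : ℝ) := by
    rw [Complex.ofReal_cos, Complex.cos]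
    push_cast
    simp only [smul_eq_mul]
    have a1 : Complex.I * k * t = k * t * Complex.I := by ring
    have a2 : Complex.I * k * -t = -(k * t) * Complex.I := by ring
    rw [a1, a2]
    ring
  rw [e2, Complex.re_mul_ofReal]

theorem tsum_indicator_range_le {ι : Type*} {f : ℤ → ℝ} (hf : Summable f) {p : ι → ℤ}
    (hp : Function.Injective p) {w : ι → ℝ} (hw : Summable w) (hfw : ∀ l, f (p l) ≤ w l) :
    ∑' k, (range p).indicator f k ≤ ∑' l, w l := by
  rw [← tsum_subtype (range p) f, tsum_range f hp]
  exact (hf.comp_injective hp).tsum_le_tsum hfw hw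

theorem le_indicator_add_indicator {A B : Set ℤ} {f : ℤ → ℝ} (hf : ∀ k, 0 ≤ f k)
    (hAB : ∀ k, f k ≠ 0 → k ∈ A ∨ k ∈ B) (k : ℤ) : f k ≤ A.indicator f k + B.indicator f k := by
  have n1 : 0 ≤ A.indicator f k := indicator_nonneg (fun _ _ => hf _) _
  have n2 : 0 ≤ B.indicator f k := indicator_nonneg (fun _ _ => hf _) _
  by_cases h0 : f k = 0
  · rw [h0]; exact add_nonneg n1 n2
  · rcases hAB k h0 with h | h
    · exact (indicator_of_mem h f).ge.trans (le_add_of_nonneg_right n2)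
    · exact (indicator_of_mem h f).ge.trans (le_add_of_nonneg_left n1)

/-- The two ranges may overlap, so the sum is dominated by two indicators instead of being split. It
serves both for tails and for residue classes. -/
theorem abs_hasSum_le_of_subset_range_union {ι : Type*} {u : ℤ → ℝ} {S : ℝ} (hS : HasSum u S)
    {p₁ p₂ : ι → ℤ} (h₁ : Function.Injective p₁) (h₂ : Function.Injective p₂)
    (hu : ∀ k, u k ≠ 0 → k ∈ range p₁ ∨ k ∈ range p₂) {w : ι → ℝ} (hw : Summable w)
    (hw₁ : ∀ l, |u (p₁ l)| ≤ w l) (hw₂ : ∀ l, |u (p₂ l)| ≤ w l) : |S| ≤ 2 * ∑' l, w l := by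
  have hsum : Summable fun k => |u k| := hS.summable.abs
  have s1 := hsum.indicator (range p₁)
  have s2 := hsum.indicator (range p₂)
  have h3 := hsum.tsum_le_tsum (le_indicator_add_indicator (fun k => abs_nonneg (u k))
    fun k hk => hu k (abs_ne_zero.1 hk)) (s1.add s2)
  rw [s1.tsum_add s2] at h3
  have h4 : |S| ≤ ∑' k, |u k| := by
    rw [← hS.tsum_eq]; exact norm_tsum_le_tsum_norm (f := u) hsum
  rw [two_mul]
  exact h4.trans (h3.trans (add_le_add (tsum_indicator_range_le hsum h₁ hw hw₁)
    (tsum_indicator_range_le hsum h₂ hw hw₂)))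

/-- A telescoping substitute for the integral test, resting on `log z ≤ z - 1` and `1 + z ≤ exp z`.
-/
theorem rpow_neg_sub_one_le {y δ : ℝ} (hy : 0 < y) (hδ : 0 < δ) :
    (y + 1) ^ (-δ - 1) ≤ (y ^ (-δ) - (y + 1) ^ (-δ)) / δ := by
  have hz : 0 < y + 1 := by linarith
  have h1 : y = (y + 1) * (1 - 1 / (y + 1)) := by field_simp; ring
  have h2 : 0 < 1 - 1 / (y + 1) := by
    rw [sub_pos, div_lt_one hz]; linarith
  have h3 : 1 + δ / (y + 1) ≤ (1 - 1 / (y + 1)) ^ (-δ) := by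
    rw [Real.rpow_def_of_pos h2]
    have := Real.log_le_sub_one_of_pos h2
    calc 1 + δ / (y + 1) ≤ Real.exp (δ / (y + 1)) := by
          linarith [Real.add_one_le_exp (δ / (y + 1))]
      _ ≤ _ := by
          apply Real.exp_le_exp.2
          have e : δ / (y + 1) = δ * (1 / (y + 1)) := by ring
          rw [e]; nlinarith
  have h4 : y ^ (-δ) = (y + 1) ^ (-δ) * (1 - 1 / (y + 1)) ^ (-δ) := by
    rw [← Real.mul_rpow hz.le h2.le, ← h1]
  rw [le_div_iff₀ hδ, h4, Real.rpow_sub_one hz.ne']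
  have h5 := Real.rpow_pos_of_pos hz (-δ)
  have e : (y + 1) ^ (-δ) / (y + 1) * δ = (y + 1) ^ (-δ) * (δ / (y + 1)) := by ring
  rw [e]; nlinarith

theorem sum_range_rpow_tail_le {δ : ℝ} (hδ : 0 < δ) {n : ℕ} (hn : 1 ≤ n) (M : ℕ) :
    ∑ m ∈ Finset.range M, ((n : ℝ) + 1 + m) ^ (-δ - 1) ≤ (n : ℝ) ^ (-δ) / δ := by
  have hn' : (0 : ℝ) < n := by exact_mod_cast hn
  have key : ∑ m ∈ Finset.range M, ((n : ℝ) + 1 + m) ^ (-δ - 1) ≤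
      ((n : ℝ) ^ (-δ) - ((n : ℝ) + M) ^ (-δ)) / δ := by
    induction M with
    | zero => simp
    | succ M ih =>
      rw [Finset.sum_range_succ]
      have := rpow_neg_sub_one_le (y := n + M) (by positivity) hδ
      have e : (n : ℝ) + 1 + M = n + M + 1 := by ring
      rw [e]
      push_cast
      rw [← add_assoc]
      refine (add_le_add ih this).trans_eq ?_
      ring
  refine key.trans ?_
  gcongr
  linarith [Real.rpow_nonneg (by positivity : (0 : ℝ) ≤ n + M) (-δ)]

theorem abs_hasSum_tail_le {u : ℤ → ℝ} {S C δ : ℝ} (hS : HasSum u S) (hδ : 0 < δ) (hC : 0 ≤ C)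
    {n : ℕ} (hn : 1 ≤ n) (h0 : ∀ k : ℤ, |k| ≤ n → u k = 0)
    (hu : ∀ k : ℤ, k ≠ 0 → |u k| ≤ C * |(k : ℝ)| ^ (-δ - 1)) :
    |S| ≤ 2 * C / δ * (n : ℝ) ^ (-δ) := by
  set w : ℕ → ℝ := fun m => ((n : ℝ) + 1 + m) ^ (-δ - 1) with hw
  have hw0 : ∀ m, 0 ≤ w m := fun m => by positivity
  have hws : Summable w := summable_of_sum_range_le hw0 (sum_range_rpow_tail_le hδ hn)
  have hwt : ∑' m, w m ≤ (n : ℝ) ^ (-δ) / δ :=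
    Real.tsum_le_of_sum_range_le hw0 (sum_range_rpow_tail_le hδ hn)
  have habs : ∀ m : ℕ, |(n : ℝ) + 1 + m| = n + 1 + m := fun m => abs_of_nonneg (by positivity)
  have := abs_hasSum_le_of_subset_range_union hS (p₁ := fun m : ℕ => (n : ℤ) + 1 + m)
    (p₂ := fun m : ℕ => -((n : ℤ) + 1 + m)) (fun a b h => by simpa using h)
    (fun a b h => by simpa using h)
    (fun k hk => by
      have hk' : (n : ℤ) < |k| := by
        by_contra hcon
        exact hk (h0 k (not_lt.1 hcon))
      rcases abs_cases k with ⟨e, _⟩ | ⟨e, _⟩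
      · exact Or.inl ⟨(k - n - 1).toNat, by simp only; omega⟩
      · exact Or.inr ⟨(-k - n - 1).toNat, by simp only; omega⟩)
    (hws.mul_left C)
    (fun m => by
      have := hu ((n : ℤ) + 1 + m) (by omega)
      push_cast at this
      rwa [habs] at this)
    (fun m => by
      have := hu (-((n : ℤ) + 1 + m)) (by omega)
      push_cast at this
      rwa [abs_neg, habs] at this)
  rw [tsum_mul_left] at this
  calc |S| ≤ 2 * (C * ∑' m, w m) := this
    _ ≤ 2 * (C * ((n : ℝ) ^ (-δ) / δ)) := by gcongr
    _ = _ := by ring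

theorem summable_max_one_abs_rpow {δ : ℝ} (hδ : 0 < δ) :
    Summable fun l : ℤ => (max 1 |(l : ℝ)|) ^ (-δ - 1) :=
  summable_of_abs_le_rpow (C := 1) hδ fun k hk => by
    have : 1 ≤ |(k : ℝ)| := by exact_mod_cast Int.one_le_abs hk
    rw [max_eq_right this, one_mul, Real.norm_of_nonneg (by positivity)]

/-- Because `N ≥ n`, `|±n + 2Nl| ≥ n max(1, |l|)`. The factor in `n` comes out and a convergent
series in `l` remains, so no power of `n` is lost as in a full tail. -/
theorem abs_hasSum_residue_le {u : ℤ → ℝ} {S C δ : ℝ} (hS : HasSum u S) (hδ : 0 < δ)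
    (hC : 0 ≤ C) {n N : ℕ} (hn : 1 ≤ n) (hN : n ≤ N)
    (h0 : ∀ k : ℤ, u k ≠ 0 → ∃ l : ℤ, k = n + 2 * N * l ∨ k = -n + 2 * N * l)
    (hu : ∀ k : ℤ, k ≠ 0 → |u k| ≤ C * |(k : ℝ)| ^ (-δ - 1)) :
    |S| ≤ 2 * C * (∑' l : ℤ, (max 1 |(l : ℝ)|) ^ (-δ - 1)) * (n : ℝ) ^ (-δ - 1) := by
  have hn' : (0 : ℝ) < n := by exact_mod_cast hn
  have hN' : (n : ℝ) ≤ N := by exact_mod_cast hN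
  have hlow : ∀ (σ : ℝ) (l : ℤ), |σ| = 1 → n * max 1 |(l : ℝ)| ≤ |σ * n + 2 * N * l| := by
    intro σ l hσ
    rcases eq_or_ne l 0 with rfl | hl
    · simp [abs_mul, hσ]
    · have h1 : 1 ≤ |(l : ℝ)| := by exact_mod_cast Int.one_le_abs hl
      rw [max_eq_right h1]
      have h2 : |2 * N * (l : ℝ)| = 2 * N * |(l : ℝ)| := by
        rw [abs_mul, abs_of_nonneg (by positivity)]
      have h3 : |σ * n| = n := by rw [abs_mul, hσ, one_mul, abs_of_pos hn']
      have h4 := abs_sub_abs_le_abs_sub (2 * N * (l : ℝ)) (-(σ * n))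
      rw [abs_neg, h2, h3, sub_neg_eq_add, add_comm (2 * (N : ℝ) * l)] at h4
      nlinarith
  have hbd : ∀ (σ : ℝ) (k l : ℤ), |σ| = 1 → (k : ℝ) = σ * n + 2 * N * l →
      |u k| ≤ C * (n : ℝ) ^ (-δ - 1) * (max 1 |(l : ℝ)|) ^ (-δ - 1) := by
    intro σ k l hσ hk
    have h1 := hlow σ l hσ
    rw [← hk] at h1
    have h2 : 0 < n * max 1 |(l : ℝ)| := by positivity
    have hk0 : k ≠ 0 := by
      rintro rfl
      simp only [Int.cast_zero, abs_zero] at h1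
      linarith
    refine (hu k hk0).trans ?_
    rw [mul_assoc, ← Real.mul_rpow hn'.le (by positivity)]
    exact mul_le_mul_of_nonneg_left (Real.rpow_le_rpow_of_nonpos h2 h1 (by linarith)) hC
  have hinj : ∀ a : ℤ, Function.Injective fun l : ℤ => a + 2 * (N : ℤ) * l := fun a x y h => by
    have hN0 : N ≠ 0 := by omega
    simpa [hN0] using h
  have := abs_hasSum_le_of_subset_range_union hS (hinj n) (hinj (-n))
    (fun k hk => by
      obtain ⟨l, h | h⟩ := h0 k hk
      · exact Or.inl ⟨l, h.symm⟩
      · exact Or.inr ⟨l, h.symm⟩)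
    ((summable_max_one_abs_rpow hδ).mul_left (C * (n : ℝ) ^ (-δ - 1)))
    (fun l => hbd 1 _ l (by simp) (by push_cast; ring))
    (fun l => hbd (-1) _ l (by simp) (by push_cast; ring))
  rw [tsum_mul_left] at this
  refine this.trans_eq ?_
  ring

/-! ### Aliasing of Chebyshev polynomials on the two node families -/

open Polynomial in
/-- Nodes at which every Chebyshev polynomial agrees, up to a factor, with one of degree at
most `n`; degree exactly `n` arises only from the residue classes of `±n` modulo `2 * N`. -/
structure ChebyshevAliasing (n N : ℕ) (v : ℕ → ℝ) : Prop where
  injOn : Set.InjOn v (Finset.range (n + 1))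
  mem : ∀ j, v j ∈ Icc (-1 : ℝ) 1
  le : n ≤ N
  alias_T : ∀ k : ℤ, ∃ (k₀ : ℤ) (σ : ℝ), |k₀| ≤ n ∧ |σ| ≤ 1 ∧
    (∀ j ≤ n, (Chebyshev.T ℝ k).eval (v j) = σ * (Chebyshev.T ℝ k₀).eval (v j)) ∧
    (σ = 0 ∨ |k₀| < n ∨ ∃ l : ℤ, k = n + 2 * N * l ∨ k = -n + 2 * N * l)

theorem chebPointI_injOn (n : ℕ) : Set.InjOn (chebPointI n) (Finset.range (n + 1)) := by
  intro i hi j hj h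
  have hpi := Real.pi_pos
  have hn : (0 : ℝ) < (n : ℝ) + 1 := by positivity
  have hmem : ∀ i ∈ (Finset.range (n + 1) : Set ℕ),
      ((i : ℝ) + 1 / 2) * Real.pi / ((n : ℝ) + 1) ∈ Icc 0 Real.pi := fun i hi => by
    have : (i : ℝ) ≤ n := by
      have := Finset.mem_range.1 (Finset.mem_coe.1 hi)
      exact_mod_cast Nat.lt_succ_iff.1 this
    refine ⟨by positivity, ?_⟩
    rw [div_le_iff₀ hn]; nlinarith
  have := Real.injOn_cos (hmem i hi) (hmem j hj) h
  rw [div_left_inj' hn.ne', mul_left_inj' hpi.ne', add_left_inj] at this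
  exact_mod_cast this

theorem exists_eq_add_two_mul (N : ℕ) (hN : 1 ≤ N) (k : ℤ) :
    ∃ k₀ l : ℤ, k = k₀ + 2 * N * l ∧ -N < k₀ ∧ k₀ ≤ N := by
  -- The offset `N - 1` places the residue in `(-N, N]`.
  refine ⟨(k + N - 1) % (2 * N) - (N - 1), (k + N - 1) / (2 * N), ?_, ?_, ?_⟩
  · have := Int.emod_add_mul_ediv (k + N - 1) (2 * N)
    linarith
  · have := Int.emod_nonneg (k + N - 1) (b := 2 * N) (by omega)
    linarith
  · have := Int.emod_lt_of_pos (k + N - 1) (b := 2 * N) (by omega)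
    linarith

/-- Changing `k` by `2(n+1)l` moves the angle by `l(2j+1)π`, hence the sign `(-1)^l`. -/
theorem chebyshevAliasing_chebPointI (n : ℕ) : ChebyshevAliasing n (n + 1) (chebPointI n) where
  injOn := chebPointI_injOn n
  mem j := ⟨Real.neg_one_le_cos _, Real.cos_le_one _⟩
  le := by omega
  alias_T k := by
    obtain ⟨k₀, l, hk, h1, h2⟩ := exists_eq_add_two_mul (n + 1) (by omega) k
    have hn : (n : ℝ) + 1 ≠ 0 := by positivity
    have hT : ∀ j, (Polynomial.Chebyshev.T ℝ k).eval (chebPointI n j) =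
        (-1) ^ l * (Polynomial.Chebyshev.T ℝ k₀).eval (chebPointI n j) := fun j => by
      rw [chebPointI, Polynomial.Chebyshev.T_real_cos, Polynomial.Chebyshev.T_real_cos]
      have e : (k : ℝ) * (((j : ℝ) + 1 / 2) * Real.pi / ((n : ℝ) + 1)) =
          k₀ * (((j : ℝ) + 1 / 2) * Real.pi / ((n : ℝ) + 1)) + (l * (2 * j + 1) : ℤ) * Real.pi := by
        rw [hk]; push_cast; field_simp
      rw [e, Real.cos_add_int_mul_pi]
      congr 1
      have hj : Odd (2 * (j : ℤ) + 1) := ⟨j, rfl⟩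
      rw [mul_comm, zpow_mul, hj.neg_one_zpow]
    rcases lt_or_eq_of_le h2 with h2 | h2
    · refine ⟨k₀, (-1) ^ l, by rw [abs_le]; omega, by simp [abs_zpow], fun j _ => hT j, ?_⟩
      right
      rcases lt_or_ge |k₀| (n : ℤ) with h | h
      · exact Or.inl h
      · right
        refine ⟨l, ?_⟩
        rcases abs_cases k₀ with ⟨e, _⟩ | ⟨e, _⟩
        · exact Or.inl (by rw [hk]; omega)
        · exact Or.inr (by rw [hk]; omega)
    -- Here `k₀ = n + 1`, and the nodes are the zeros of `T_{n+1}`.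
    · refine ⟨0, 0, by simp, by simp, fun j _ => ?_, Or.inl rfl⟩
      rw [hT, chebPointI, Polynomial.Chebyshev.T_real_cos, h2]
      have e : (((n + 1 : ℕ) : ℤ) : ℝ) * (((j : ℝ) + 1 / 2) * Real.pi / ((n : ℝ) + 1)) =
          Real.pi / 2 + j * Real.pi := by
        push_cast; field_simp; ring
      rw [e, Real.cos_add_nat_mul_pi, Real.cos_pi_div_two]
      ring

/-- Changing `k` by `2nl` moves the angle by a multiple of `2π`, so no sign appears. -/
theorem chebyshevAliasing_node {n : ℕ} (hn : 1 ≤ n) :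
    ChebyshevAliasing n n (Polynomial.Chebyshev.node n) where
  injOn := (Polynomial.Chebyshev.strictAntiOn_node n).injOn
  mem j := Polynomial.Chebyshev.node_mem_Icc
  le := le_rfl
  alias_T k := by
    obtain ⟨k₀, l, hk, h1, h2⟩ := exists_eq_add_two_mul n hn k
    have hn0 : (n : ℝ) ≠ 0 := by positivity
    refine ⟨k₀, 1, by rw [abs_le]; omega, by simp, fun j _ => ?_, ?_⟩
    · rw [Polynomial.Chebyshev.node, Polynomial.Chebyshev.T_real_cos,
        Polynomial.Chebyshev.T_real_cos, one_mul]
      have e : (k : ℝ) * ((j : ℝ) * Real.pi / n) =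
          k₀ * ((j : ℝ) * Real.pi / n) + (l * j : ℤ) * (2 * Real.pi) := by
        rw [hk]; push_cast; field_simp
      rw [e, Real.cos_add_int_mul_two_pi]
    · right
      rcases lt_or_ge |k₀| (n : ℤ) with h | h
      · exact Or.inl h
      · right
        refine ⟨l, ?_⟩
        rcases abs_cases k₀ with ⟨e, _⟩ | ⟨e, _⟩
        · exact Or.inl (by rw [hk]; omega)
        · exact Or.inr (by rw [hk]; omega)

/-! ### Interpolation error from Chebyshev coefficients -/

open Polynomial

theorem eval_interpolate_eq_sum (s : Finset ℕ) (v r : ℕ → ℝ) (x : ℝ) :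
    (Lagrange.interpolate s v r).eval x = ∑ j ∈ s, r j * (Lagrange.basis s v j).eval x := by
  rw [Lagrange.interpolate_apply, eval_finsetSum]
  simp

theorem hasSum_eval_interpolate {s : Finset ℕ} {v : ℕ → ℝ} {u : ℤ → ℕ → ℝ} {r : ℕ → ℝ}
    (h : ∀ j ∈ s, HasSum (fun k => u k j) (r j)) (x : ℝ) :
    HasSum (fun k => (Lagrange.interpolate s v (u k)).eval x)
      ((Lagrange.interpolate s v r).eval x) := by
  simp_rw [eval_interpolate_eq_sum]
  exact hasSum_sum fun j hj => (h j hj).mul_right _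

theorem eval_interpolate_of_eval_eq {n : ℕ} {v : ℕ → ℝ}
    (hv : Set.InjOn v (Finset.range (n + 1))) {r : ℕ → ℝ} (p : ℝ[X]) (hp : p.natDegree ≤ n)
    (h : ∀ j ≤ n, r j = p.eval (v j)) (x : ℝ) :
    (Lagrange.interpolate (Finset.range (n + 1)) v r).eval x = p.eval x := by
  rw [Lagrange.eq_interpolate_of_eval_eq r hv (f := p)]
  · rw [Finset.card_range]
    exact degree_le_natDegree.trans_lt (by exact_mod_cast Nat.lt_succ_of_le hp)
  · intro j hj
    exact (h j (by simpa [Nat.lt_succ_iff] using hj)).symm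

namespace ChebyshevAliasing

/-- By aliasing the interpolant is `σ T_{k₀}`. This bound, uniform in `n`, is why no Lebesgue
constant enters. -/
theorem abs_eval_interpolate_T_le {n N : ℕ} {v : ℕ → ℝ} (h : ChebyshevAliasing n N v)
    (k : ℤ) {x : ℝ} (hx : x ∈ Icc (-1 : ℝ) 1) :
    |(Lagrange.interpolate (Finset.range (n + 1)) v
      (fun j => (Chebyshev.T ℝ k).eval (v j))).eval x| ≤ 1 := by
  obtain ⟨k₀, σ, hk₀, hσ, hT, -⟩ := h.alias_T k
  rw [eval_interpolate_of_eval_eq h.injOn (C σ * Chebyshev.T ℝ k₀)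
    ((natDegree_C_mul_le _ _).trans (by
      rw [Chebyshev.natDegree_T]; rw [Int.abs_eq_natAbs] at hk₀; omega))
    (fun j hj => by rw [hT j hj, eval_mul, eval_C]), eval_mul, eval_C, abs_mul]
  exact mul_le_one₀ hσ (abs_nonneg _) (Chebyshev.abs_eval_T_real_le_one k₀ (abs_le.2 hx))

theorem eval_interpolate_T {n N : ℕ} {v : ℕ → ℝ} (h : ChebyshevAliasing n N v)
    {k : ℤ} (hk : |k| ≤ n) (x : ℝ) :
    (Lagrange.interpolate (Finset.range (n + 1)) v
      (fun j => (Chebyshev.T ℝ k).eval (v j))).eval x = (Chebyshev.T ℝ k).eval x :=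
  eval_interpolate_of_eval_eq h.injOn _ (by
    rw [Chebyshev.natDegree_T]; rw [Int.abs_eq_natAbs] at hk; omega)
    (fun _ _ => rfl) x

end ChebyshevAliasing


theorem eval_T_mul_sub (k : ℤ) (ξ x : ℝ) :
    (x - ξ) * (Chebyshev.T ℝ k).eval x = ((Chebyshev.T ℝ (k + 1)).eval x +
      (Chebyshev.T ℝ (k - 1)).eval x) / 2 - ξ * (Chebyshev.T ℝ k).eval x := by
  rw [Chebyshev.T_add_one]
  simp only [eval_sub, eval_mul, eval_X, eval_ofNat]
  ring

namespace ChebyshevAliasing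

/-- Interpolation commutes with multiplication by `x - ξ` on Chebyshev polynomials, up to a
bounded error that is supported on the residue classes of `±n` modulo `2 * N`. -/
theorem commutator_T {n N : ℕ} {v : ℕ → ℝ} (h : ChebyshevAliasing n N v)
    (k : ℤ) (ξ : ℝ) {x : ℝ} (hx : x ∈ Icc (-1 : ℝ) 1) :
    ∃ e : ℝ, e = (x - ξ) * (Lagrange.interpolate (Finset.range (n + 1)) v
        (fun j => (Chebyshev.T ℝ k).eval (v j))).eval x -
      (Lagrange.interpolate (Finset.range (n + 1)) v
        (fun j => (v j - ξ) * (Chebyshev.T ℝ k).eval (v j))).eval x ∧ |e| ≤ 2 ∧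
      (e ≠ 0 → ∃ l : ℤ, k = n + 2 * N * l ∨ k = -n + 2 * N * l) := by
  refine ⟨_, rfl, ?_, fun he => ?_⟩
  -- By the three-term recurrence the `ξ` terms cancel, leaving `x` times one interpolant minus the
  -- mean of two others.
  · have e1 : (Lagrange.interpolate (Finset.range (n + 1)) v
        (fun j => (v j - ξ) * (Chebyshev.T ℝ k).eval (v j))).eval x =
        ((Lagrange.interpolate (Finset.range (n + 1)) v
          (fun j => (Chebyshev.T ℝ (k + 1)).eval (v j))).eval x +
        (Lagrange.interpolate (Finset.range (n + 1)) v
          (fun j => (Chebyshev.T ℝ (k - 1)).eval (v j))).eval x) / 2 -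
        ξ * (Lagrange.interpolate (Finset.range (n + 1)) v
          (fun j => (Chebyshev.T ℝ k).eval (v j))).eval x := by
      simp only [eval_interpolate_eq_sum, eval_T_mul_sub]
      rw [← Finset.sum_add_distrib, Finset.sum_div, Finset.mul_sum, ← Finset.sum_sub_distrib]
      exact Finset.sum_congr rfl fun j _ => by ring
    have h0 := h.abs_eval_interpolate_T_le k hx
    have h1 := h.abs_eval_interpolate_T_le (k + 1) hx
    have h2 := h.abs_eval_interpolate_T_le (k - 1) hx
    rw [e1]
    have h3 := abs_mul x ((Lagrange.interpolate (Finset.range (n + 1)) v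
      (fun j => (Chebyshev.T ℝ k).eval (v j))).eval x)
    have h4 := mul_le_one₀ (abs_le.2 hx) (abs_nonneg _) h0
    rw [← h3] at h4
    rw [abs_le] at h1 h2 h4 ⊢
    constructor <;> linarith
  · obtain ⟨k₀, σ, hk₀, -, hT, hcase⟩ := h.alias_T k
    have hint := eval_interpolate_of_eval_eq h.injOn
      (r := fun j => (Chebyshev.T ℝ k).eval (v j)) (C σ * Chebyshev.T ℝ k₀)
      ((natDegree_C_mul_le _ _).trans (by
        rw [Chebyshev.natDegree_T]; rw [Int.abs_eq_natAbs] at hk₀; omega))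
      (fun j hj => by simp only [hT j hj, eval_mul, eval_C]) x
    -- If the product still has degree at most `n` it is its own interpolant, and the commutator
    -- vanishes.
    have hzero : ((X - C ξ) * (C σ * Chebyshev.T ℝ k₀)).natDegree ≤ n → False := fun hdeg => by
      apply he
      rw [hint, eval_interpolate_of_eval_eq h.injOn _ hdeg
        (fun j hj => by rw [hT j hj]; simp)]
      simp
    rcases hcase with hσ | hlt | hl
    · exact (hzero (by simp [hσ])).elim
    · refine (hzero (natDegree_mul_le.trans ?_)).elim
      have := (natDegree_C_mul_le σ (Chebyshev.T ℝ k₀))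
      rw [Chebyshev.natDegree_T] at this
      rw [Int.abs_eq_natAbs] at hlt
      rw [natDegree_X_sub_C]
      omega
    · exact hl

/-- Terms with `|k| ≤ n` are reproduced exactly, and every other term costs at most `2 |a k|`. -/
theorem abs_sub_eval_interpolate_le {n N : ℕ} {v : ℕ → ℝ} (h : ChebyshevAliasing n N v)
    (hn : 1 ≤ n) {f : ℝ → ℝ} {a : ℤ → ℝ} {A δ : ℝ} (hA : 0 ≤ A) (hδ : 0 < δ)
    (hf : ∀ x ∈ Icc (-1 : ℝ) 1, HasSum (fun k => a k * (Chebyshev.T ℝ k).eval x) (f x))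
    (ha : ∀ k : ℤ, k ≠ 0 → |a k| ≤ A * |(k : ℝ)| ^ (-δ - 1)) {x : ℝ} (hx : x ∈ Icc (-1 : ℝ) 1) :
    |f x - (Lagrange.interpolate (Finset.range (n + 1)) v (fun j => f (v j))).eval x| ≤
      4 * A / δ * (n : ℝ) ^ (-δ) := by
  have hP := hasSum_eval_interpolate (s := Finset.range (n + 1)) (v := v)
    (r := fun j => f (v j)) (fun j _ => hf (v j) (h.mem j)) x
  have e : ∀ k, (Lagrange.interpolate (Finset.range (n + 1)) v
      (fun j => a k * (Chebyshev.T ℝ k).eval (v j))).eval x =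
      a k * (Lagrange.interpolate (Finset.range (n + 1)) v
        (fun j => (Chebyshev.T ℝ k).eval (v j))).eval x := fun k => by
    simp only [eval_interpolate_eq_sum, Finset.mul_sum, mul_assoc]
  simp_rw [e] at hP
  have := abs_hasSum_tail_le (C := 2 * A) ((hf x hx).sub hP) hδ (by positivity) hn
    (fun k hk => by rw [h.eval_interpolate_T hk, sub_self])
    (fun k hk => by
      rw [← mul_sub, abs_mul]
      have h1 := h.abs_eval_interpolate_T_le k hx
      have h2 := Chebyshev.abs_eval_T_real_le_one k (abs_le.2 hx)
      have h3 := abs_sub ((Chebyshev.T ℝ k).eval x)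
        ((Lagrange.interpolate (Finset.range (n + 1)) v
          (fun j => (Chebyshev.T ℝ k).eval (v j))).eval x)
      rw [mul_comm 2 A, mul_right_comm]
      exact mul_le_mul (ha k hk) (by linarith) (abs_nonneg _) (by positivity))
  refine this.trans_eq ?_
  ring

theorem abs_sub_mul_abs_sub_eval_interpolate_le {n N : ℕ} {v : ℕ → ℝ}
    (h : ChebyshevAliasing n N v) (hn : 1 ≤ n) {f : ℝ → ℝ} {a b : ℤ → ℝ} {ξ A B δ : ℝ}
    (hA : 0 ≤ A) (hB : 0 ≤ B) (hδ : 0 < δ)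
    (hf : ∀ x ∈ Icc (-1 : ℝ) 1, HasSum (fun k => a k * (Chebyshev.T ℝ k).eval x) (f x))
    (hf' : ∀ x ∈ Icc (-1 : ℝ) 1,
      HasSum (fun k => b k * (Chebyshev.T ℝ k).eval x) ((x - ξ) * f x))
    (ha : ∀ k : ℤ, k ≠ 0 → |a k| ≤ A * |(k : ℝ)| ^ (-δ - 1))
    (hb : ∀ k : ℤ, k ≠ 0 → |b k| ≤ B * |(k : ℝ)| ^ (-(δ + 1) - 1))
    {x : ℝ} (hx : x ∈ Icc (-1 : ℝ) 1) :
    |x - ξ| * |f x - (Lagrange.interpolate (Finset.range (n + 1)) v (fun j => f (v j))).eval x| ≤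
      (4 * B / (δ + 1) + 4 * A * ∑' l : ℤ, (max 1 |(l : ℝ)|) ^ (-δ - 1)) *
        (n : ℝ) ^ (-δ - 1) := by
  have hsm := h.abs_sub_eval_interpolate_le hn (f := fun x => (x - ξ) * f x) hB
    (by linarith : 0 < δ + 1) hf' hb hx
  have hP := hasSum_eval_interpolate (s := Finset.range (n + 1)) (v := v)
    (r := fun j => f (v j)) (fun j _ => hf (v j) (h.mem j)) x
  have hP' := hasSum_eval_interpolate (s := Finset.range (n + 1)) (v := v)
    (r := fun j => (v j - ξ) * f (v j))
    (fun j _ => (hf (v j) (h.mem j)).mul_left (v j - ξ)) x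
  have hE := (hP.mul_left (x - ξ)).sub hP'
  choose e he he2 he3 using fun k => h.commutator_T k ξ hx
  have ee : ∀ k, (x - ξ) * (Lagrange.interpolate (Finset.range (n + 1)) v
      (fun j => a k * (Chebyshev.T ℝ k).eval (v j))).eval x -
      (Lagrange.interpolate (Finset.range (n + 1)) v
        (fun j => (v j - ξ) * (a k * (Chebyshev.T ℝ k).eval (v j)))).eval x = a k * e k :=
    fun k => by
      rw [he k]
      simp only [eval_interpolate_eq_sum, Finset.mul_sum, ← Finset.sum_sub_distrib]
      exact Finset.sum_congr rfl fun j _ => by ring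
  simp_rw [ee] at hE
  have hres := abs_hasSum_residue_le (C := 2 * A) hE hδ (by positivity) hn h.le
    (fun k hk => he3 k (right_ne_zero_of_mul hk))
    (fun k hk => by
      rw [abs_mul, mul_comm 2 A, mul_right_comm]
      exact mul_le_mul (ha k hk) (he2 k) (abs_nonneg _) (by positivity))
  rw [neg_add'] at hsm
  rw [← abs_mul, add_mul]
  set P := (Lagrange.interpolate (Finset.range (n + 1)) v (fun j => f (v j))).eval x
  set P' := (Lagrange.interpolate (Finset.range (n + 1)) v
    (fun j => (v j - ξ) * f (v j))).eval x
  have e4 : (x - ξ) * (f x - P) = ((x - ξ) * f x - P') - ((x - ξ) * P - P') := by ring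
  rw [e4]
  refine (abs_sub _ _).trans (add_le_add hsm (hres.trans_eq ?_))
  ring

end ChebyshevAliasing


/-- The interpolation error of `f` at Chebyshev nodes is of order `γ`, and of order
`γ + 1` away from `ξ`. -/
def HasInterpolationOrder (f : ℝ → ℝ) (ξ γ : ℝ) : Prop :=
  ∃ K : ℝ, 0 ≤ K ∧ ∀ (n N : ℕ) (v : ℕ → ℝ), 1 ≤ n → ChebyshevAliasing n N v →
    ∀ x ∈ Icc (-1 : ℝ) 1,
      |f x - (Lagrange.interpolate (Finset.range (n + 1)) v (fun j => f (v j))).eval x| ≤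
        K * (n : ℝ) ^ (-γ) ∧
      |x - ξ| *
        |f x - (Lagrange.interpolate (Finset.range (n + 1)) v (fun j => f (v j))).eval x| ≤
        K * (n : ℝ) ^ (-γ - 1)

/-- A function that behaves in `θ = arccos x` like `|s| ^ γ` times a smooth function, where `s` is
smooth with simple zeros, is interpolated to order `γ`, and to order `γ + 1` away from `ξ`. -/
theorem hasInterpolationOrder_of_abs_rpow {γ : ℝ} (hγ : 0 < γ) {r : ℕ} (hr : γ + 3 ≤ r)
    {s q q' f : ℝ → ℝ} {ξ : ℝ} (hs : ∀ n : ℕ, ContDiff ℝ n s) (hq : ContDiff ℝ r q)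
    (hq' : ContDiff ℝ r q') (hlip : ∀ x y, |s x - s y| ≤ |x - y|) {c a a' : ℝ} (hc : 0 < c)
    (hlow : ∀ t ∈ Icc (0 : ℝ) (2 * Real.pi), c * |t - a| ≤ |s t| ∨ c * |t - a'| ≤ |s t|)
    (hf : ∀ t, f (Real.cos t) = |s t| ^ γ * q t)
    (hf' : ∀ t, (Real.cos t - ξ) * f (Real.cos t) = |s t| ^ γ * s t * q' t) :
    HasInterpolationOrder f ξ γ := by
  have hsc : Continuous s := (hs 0).continuous
  -- Used with `i = 0` for `f` and `i = 1` for `(x - ξ) f`; the latter is what requires `γ + 3 ≤ r`.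
  have series : ∀ (i : ℕ) (p u : ℝ → ℝ), i ≤ 1 → ContDiff ℝ r p →
      (∀ t, u (Real.cos t) = |s t| ^ γ * s t ^ i * p t) →
      ∃ (b : ℤ → ℝ) (B : ℝ), 0 ≤ B ∧
        (∀ k : ℤ, k ≠ 0 → |b k| ≤ B * |(k : ℝ)| ^ (-(γ + i) - 1)) ∧
        ∀ x ∈ Icc (-1 : ℝ) 1, HasSum (fun k => b k * (Chebyshev.T ℝ k).eval x) (u x) := by
    intro i p u hi hp hu
    have hi' : (i : ℝ) ≤ 1 := by exact_mod_cast hi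
    have hF : (fun t => |s t| ^ γ * s t ^ i * p t) = fun t => u (Real.cos t) := by
      funext t; exact (hu t).symm
    have hper : Function.Periodic (fun t => |s t| ^ γ * s t ^ i * p t) (2 * Real.pi) := by
      rw [hF]; intro t; simp
    obtain ⟨B, hB, hbound⟩ := exists_norm_fourier_integral_le hγ (by linarith) hs hp hlip hc
      hlow hper
    obtain ⟨b, hb, hsum⟩ := exists_hasSum_cos (F := fun t => |s t| ^ γ * s t ^ i * p t)
      (((hsc.abs.rpow_const fun _ => Or.inr hγ.le).mul (hsc.pow i)).mul hp.continuous) hper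
      (fun t => by rw [← hu, ← hu, Real.cos_neg]) (by positivity : 0 < γ + i) hbound
    refine ⟨b, B, hB, hb, fun x hx => ?_⟩
    have := hsum (Real.arccos x)
    rw [← hu, Real.cos_arccos hx.1 hx.2] at this
    refine this.congr_fun fun k => ?_
    rw [← Chebyshev.T_real_cos, Real.cos_arccos hx.1 hx.2]
  obtain ⟨b, B, hB, hb, hsum⟩ := series 0 q f (by norm_num) hq (by simpa using hf)
  obtain ⟨b', B', hB', hb', hsum'⟩ := series 1 q' (fun x => (x - ξ) * f x) le_rfl hq'
    (by simpa using hf')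
  simp only [Nat.cast_zero, add_zero, Nat.cast_one] at hb hb'
  have hΩ : 0 ≤ ∑' l : ℤ, (max 1 |(l : ℝ)|) ^ (-γ - 1) := tsum_nonneg fun l => by positivity
  have k1 : 0 ≤ 4 * B / γ := by positivity
  have k2 : 0 ≤ 4 * B' / (γ + 1) + 4 * B * ∑' l : ℤ, (max 1 |(l : ℝ)|) ^ (-γ - 1) := by
    positivity
  refine ⟨4 * B / γ + (4 * B' / (γ + 1) + 4 * B * ∑' l : ℤ, (max 1 |(l : ℝ)|) ^ (-γ - 1)),
    add_nonneg k1 k2, fun n N v hn h x hx => ⟨?_, ?_⟩⟩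
  · refine (h.abs_sub_eval_interpolate_le hn hB hγ hsum hb hx).trans ?_
    exact mul_le_mul_of_nonneg_right (le_add_of_nonneg_right k2) (by positivity)
  · refine (h.abs_sub_mul_abs_sub_eval_interpolate_le hn hB hB' hγ hsum hsum' hb hb' hx).trans ?_
    exact mul_le_mul_of_nonneg_right (le_add_of_nonneg_left k1) (by positivity)

theorem exists_error_le_of_le_abs_sub {γ ξ K : ℝ} {f : ℝ → ℝ} {p : ℕ → ℝ[X]} (hK : 0 ≤ K)
    (h : ∀ n, 1 ≤ n → ∀ x ∈ Icc (-1 : ℝ) 1, |f x - (p n).eval x| ≤ K * (n : ℝ) ^ (-γ) ∧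
      |x - ξ| * |f x - (p n).eval x| ≤ K * (n : ℝ) ^ (-γ - 1)) {ε : ℝ} (hε : 0 < ε) :
    ∃ C : ℝ, ∀ n : ℕ, 1 ≤ n → ∀ x ∈ Icc (-1 : ℝ) 1,
      |f x - (p n).eval x| ≤ C * (n : ℝ) ^ (-γ) ∧
      (ε ≤ |x - ξ| → |f x - (p n).eval x| ≤ C * (n : ℝ) ^ (-γ - 1)) := by
  refine ⟨K + K / ε, fun n hn x hx => ⟨(h n hn x hx).1.trans ?_, fun hfar => ?_⟩⟩
  · gcongr
    exact le_add_of_nonneg_right (by positivity)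
  · have h1 : ε * |f x - (p n).eval x| ≤ K * (n : ℝ) ^ (-γ - 1) :=
      (mul_le_mul_of_nonneg_right hfar (abs_nonneg _)).trans (h n hn x hx).2
    have h2 : |f x - (p n).eval x| ≤ K / ε * (n : ℝ) ^ (-γ - 1) := by
      rw [div_mul_eq_mul_div, le_div_iff₀ hε]; linarith
    refine h2.trans ?_
    gcongr
    exact le_add_of_nonneg_left hK

/-! ### Singularity inside the interval and at its endpoints -/

theorem abs_div_pi_le_abs_sin_half {y : ℝ} (hy : |y| ≤ Real.pi) :
    Real.pi⁻¹ * |y| ≤ |Real.sin (y / 2)| := by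
  have h := Real.mul_abs_le_abs_sin (x := y / 2) (by rw [abs_div, abs_two]; linarith)
  rw [abs_div, abs_two] at h
  refine le_of_eq_of_le ?_ h
  ring

/-- Factor the difference as `-2 sin((t+φ)/2) sin((t-φ)/2)`. The first sine stays away from zero
since `φ` is interior; the second is handled by Jordan's inequality. -/
theorem mul_abs_sub_le_abs_cos_sub_cos {φ t : ℝ} (h0 : 0 < φ) (hφ : φ < Real.pi)
    (ht : t ∈ Icc 0 Real.pi) :
    2 * (Real.pi⁻¹ * min φ (Real.pi - φ)) * Real.pi⁻¹ * |t - φ| ≤ |Real.cos t - Real.cos φ| := by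
  have hpi := Real.pi_pos
  have h1 : Real.pi⁻¹ * |t - φ| ≤ |Real.sin ((t - φ) / 2)| :=
    abs_div_pi_le_abs_sin_half (by rw [abs_le]; constructor <;> linarith [ht.1, ht.2])
  have h2 : Real.pi⁻¹ * min φ (Real.pi - φ) ≤ |Real.sin ((t + φ) / 2)| := by
    rcases le_total (t + φ) Real.pi with h | h
    · have := abs_div_pi_le_abs_sin_half (y := t + φ)
        (by rw [abs_le]; constructor <;> linarith [ht.1])
      refine le_trans ?_ this
      gcongr
      exact (min_le_left _ _).trans (by rw [abs_of_nonneg] <;> linarith [ht.1])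
    · have := abs_div_pi_le_abs_sin_half (y := 2 * Real.pi - (t + φ))
        (by rw [abs_le]; constructor <;> linarith [ht.2])
      have e : (2 * Real.pi - (t + φ)) / 2 = Real.pi - (t + φ) / 2 := by ring
      rw [e, Real.sin_pi_sub] at this
      refine le_trans ?_ this
      gcongr
      exact (min_le_right _ _).trans (by rw [abs_of_nonneg] <;> linarith [ht.2])
  rw [Real.cos_sub_cos, abs_mul, abs_mul, abs_neg, abs_two, mul_assoc _ Real.pi⁻¹, mul_assoc 2,
    mul_assoc 2]
  exact mul_le_mul_of_nonneg_left (mul_le_mul h2 h1 (by positivity) (abs_nonneg _)) (by norm_num)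

theorem abs_half_sub_half_le (x y : ℝ) : |x / 2 - y / 2| ≤ |x - y| := by
  rw [← sub_div, abs_div, abs_two]
  linarith [abs_nonneg (x - y)]

theorem contDiff_comp_cos {g : ℝ → ℝ} {m : ℕ} (hg : ContDiffOn ℝ m g (Icc (-1) 1)) :
    ContDiff ℝ m (fun t => g (Real.cos t)) := by
  rw [← contDiffOn_univ]
  exact hg.comp Real.contDiff_cos.contDiffOn fun t _ => Real.cos_mem_Icc t

theorem hasInterpolationOrder_modelFun_interior {α ξ : ℝ} (hα : 0 < α)
    (hξ : ξ ∈ Ioo (-1 : ℝ) 1) {m : ℕ} (hm : α + 3 ≤ m) {g : ℝ → ℝ}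
    (hg : ContDiffOn ℝ m g (Icc (-1) 1)) :
    HasInterpolationOrder (modelFun α ξ g) ξ α := by
  have hpi := Real.pi_pos
  set φ := Real.arccos ξ with hφ
  have hcos : Real.cos φ = ξ := Real.cos_arccos hξ.1.le hξ.2.le
  have h0 : 0 < φ := Real.arccos_pos.2 hξ.2
  have h1 : φ < Real.pi := by
    refine lt_of_le_of_ne (Real.arccos_le_pi ξ) fun h => ?_
    rw [h, Real.cos_pi] at hcos
    linarith [hξ.1]
  have hmin : 0 < min φ (Real.pi - φ) := lt_min h0 (by linarith)
  refine hasInterpolationOrder_of_abs_rpow (s := fun t => Real.cos t - ξ)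
    (q := fun t => g (Real.cos t)) (q' := fun t => g (Real.cos t)) hα hm
    (fun n => Real.contDiff_cos.sub contDiff_const) (contDiff_comp_cos hg) (contDiff_comp_cos hg)
    (fun x y => by rw [sub_sub_sub_cancel_right]; exact Real.abs_cos_sub_cos_le x y)
    (c := 2 * (Real.pi⁻¹ * min φ (Real.pi - φ)) * Real.pi⁻¹) (a := φ) (a' := 2 * Real.pi - φ)
    (by positivity) (fun t ht => ?_) (fun t => rfl) (fun t => by simp only [modelFun]; ring)
  rw [← hcos]
  rcases le_total t Real.pi with h | h
  · exact Or.inl (mul_abs_sub_le_abs_cos_sub_cos h0 h1 ⟨ht.1, h⟩)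
  · right
    have := mul_abs_sub_le_abs_cos_sub_cos h0 h1 (t := 2 * Real.pi - t)
      ⟨by linarith [ht.2], by linarith⟩
    rw [Real.cos_two_pi_sub] at this
    rwa [abs_sub_comm t, sub_right_comm]

theorem abs_two_mul_sq_rpow (x α : ℝ) : |2 * x ^ 2| ^ α = 2 ^ α * |x| ^ (2 * α) := by
  rw [abs_mul, abs_two, abs_pow, Real.mul_rpow (by norm_num) (by positivity),
    Real.rpow_mul (abs_nonneg x), Real.rpow_two]

/-- Since `cos t - 1 = -2 sin²(t/2)`, the exponent doubles. Multiplication by `x - 1` yields two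
factors `s`; one suffices and the other goes into `q'`. -/
theorem hasInterpolationOrder_modelFun_one {α : ℝ} (hα : 0 < α) {m : ℕ}
    (hm : 2 * α + 3 ≤ m) {g : ℝ → ℝ} (hg : ContDiffOn ℝ m g (Icc (-1) 1)) :
    HasInterpolationOrder (modelFun α 1 g) 1 (2 * α) := by
  have hpi := Real.pi_pos
  have hs : ∀ n : ℕ, ContDiff ℝ n fun t : ℝ => Real.sin (t / 2) := fun n =>
    Real.contDiff_sin.comp (contDiff_id.div_const 2)
  have hcos : ∀ t : ℝ, Real.cos t - 1 = -(2 * Real.sin (t / 2) ^ 2) := fun t => by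
    have := Real.cos_sq (t / 2)
    rw [mul_div_cancel₀ t (by norm_num : (2 : ℝ) ≠ 0)] at this
    have := Real.sin_sq (t / 2)
    linarith
  have hq : ContDiff ℝ m fun t => 2 ^ α * g (Real.cos t) :=
    contDiff_const.mul (contDiff_comp_cos hg)
  have hf : ∀ t, modelFun α 1 g (Real.cos t) =
      |Real.sin (t / 2)| ^ (2 * α) * (2 ^ α * g (Real.cos t)) := fun t => by
    rw [modelFun, hcos, abs_neg, abs_two_mul_sq_rpow]; ring
  refine hasInterpolationOrder_of_abs_rpow (s := fun t => Real.sin (t / 2))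
    (q' := fun t => -2 * Real.sin (t / 2) * (2 ^ α * g (Real.cos t))) (by positivity) hm hs hq
    ((contDiff_const.mul (hs m)).mul hq)
    (fun x y => (Real.abs_sin_sub_sin_le _ _).trans (abs_half_sub_half_le x y))
    (c := Real.pi⁻¹) (a := 0) (a' := 2 * Real.pi) (by positivity) (fun t ht => ?_) hf
    (fun t => by rw [hf, hcos]; ring)
  rcases le_total t Real.pi with h | h
  · left
    rw [sub_zero]
    exact abs_div_pi_le_abs_sin_half (by rw [abs_of_nonneg ht.1]; exact h)
  · right
    have := abs_div_pi_le_abs_sin_half (y := 2 * Real.pi - t)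
      (by rw [abs_le]; constructor <;> linarith [ht.2])
    have e : (2 * Real.pi - t) / 2 = Real.pi - t / 2 := by ring
    rwa [e, Real.sin_pi_sub, abs_sub_comm] at this

theorem hasInterpolationOrder_modelFun_neg_one {α : ℝ} (hα : 0 < α) {m : ℕ}
    (hm : 2 * α + 3 ≤ m) {g : ℝ → ℝ} (hg : ContDiffOn ℝ m g (Icc (-1) 1)) :
    HasInterpolationOrder (modelFun α (-1) g) (-1) (2 * α) := by
  have hpi := Real.pi_pos
  have hs : ∀ n : ℕ, ContDiff ℝ n fun t : ℝ => Real.cos (t / 2) := fun n =>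
    Real.contDiff_cos.comp (contDiff_id.div_const 2)
  have hcos : ∀ t : ℝ, Real.cos t - (-1) = 2 * Real.cos (t / 2) ^ 2 := fun t => by
    have := Real.cos_sq (t / 2)
    rw [mul_div_cancel₀ t (by norm_num : (2 : ℝ) ≠ 0)] at this
    linarith
  have hq : ContDiff ℝ m fun t => 2 ^ α * g (Real.cos t) :=
    contDiff_const.mul (contDiff_comp_cos hg)
  have hf : ∀ t, modelFun α (-1) g (Real.cos t) =
      |Real.cos (t / 2)| ^ (2 * α) * (2 ^ α * g (Real.cos t)) := fun t => by
    rw [modelFun, hcos, abs_two_mul_sq_rpow]; ring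
  refine hasInterpolationOrder_of_abs_rpow (s := fun t => Real.cos (t / 2))
    (q' := fun t => 2 * Real.cos (t / 2) * (2 ^ α * g (Real.cos t))) (by positivity) hm hs hq
    ((contDiff_const.mul (hs m)).mul hq)
    (fun x y => (Real.abs_cos_sub_cos_le _ _).trans (abs_half_sub_half_le x y))
    -- `cos (t / 2)` has the single zero `π` in the period, so both centres coincide.
    (c := Real.pi⁻¹) (a := Real.pi) (a' := Real.pi) (by positivity) (fun t ht => Or.inl ?_) hf
    (fun t => by rw [hf, hcos]; ring)
  have := abs_div_pi_le_abs_sin_half (y := Real.pi - t)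
    (by rw [abs_le]; constructor <;> linarith [ht.1, ht.2])
  rwa [sub_div, Real.sin_pi_div_two_sub, abs_sub_comm] at this

/-! ### Conclusion for both node families -/

theorem HasInterpolationOrder.chebInterpI {f : ℝ → ℝ} {ξ γ : ℝ}
    (h : HasInterpolationOrder f ξ γ) {ε : ℝ} (hε : 0 < ε) :
    ∃ C : ℝ, ∀ n : ℕ, 1 ≤ n → ∀ x ∈ Icc (-1 : ℝ) 1,
      |f x - (chebInterpI f n).eval x| ≤ C * (n : ℝ) ^ (-γ) ∧
      (ε ≤ |x - ξ| → |f x - (chebInterpI f n).eval x| ≤ C * (n : ℝ) ^ (-γ - 1)) := by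
  obtain ⟨K, hK, H⟩ := h
  exact exists_error_le_of_le_abs_sub hK
    (fun n hn => H n (n + 1) _ hn (chebyshevAliasing_chebPointI n)) hε

theorem HasInterpolationOrder.chebInterpII {f : ℝ → ℝ} {ξ γ : ℝ}
    (h : HasInterpolationOrder f ξ γ) {ε : ℝ} (hε : 0 < ε) :
    ∃ C : ℝ, ∀ n : ℕ, 1 ≤ n → ∀ x ∈ Icc (-1 : ℝ) 1,
      |f x - (chebInterpII f n).eval x| ≤ C * (n : ℝ) ^ (-γ) ∧
      (ε ≤ |x - ξ| → |f x - (chebInterpII f n).eval x| ≤ C * (n : ℝ) ^ (-γ - 1)) := by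
  obtain ⟨K, hK, H⟩ := h
  exact exists_error_le_of_le_abs_sub hK
    (fun n hn => H n n _ hn (chebyshevAliasing_node hn)) hε

theorem mainTheorem2 (α : ℝ) (hα : 0 < α) :
    ∃ m : ℕ, ∀ (ξ : ℝ) (g : ℝ → ℝ), ContDiffOn ℝ m g (Icc (-1) 1) →
      (ξ ∈ Ioo (-1 : ℝ) 1 → (∀ k : ℕ, α ≠ 2 * (k : ℝ)) → ∀ ε : ℝ, 0 < ε →
        (∃ C : ℝ, ∀ n : ℕ, 1 ≤ n → ∀ x ∈ Icc (-1 : ℝ) 1, (∀ j ≤ n, x ≠ chebPointI n j) →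
          (|x - ξ| < ε →
            |modelFun α ξ g x - (chebInterpI (modelFun α ξ g) n).eval x|
              ≤ C * (n : ℝ) ^ (-α)) ∧
          (¬ |x - ξ| < ε →
            |modelFun α ξ g x - (chebInterpI (modelFun α ξ g) n).eval x|
              ≤ C * (n : ℝ) ^ (-α - 1))) ∧
        (∃ C : ℝ, ∀ n : ℕ, 1 ≤ n → ∀ x ∈ Icc (-1 : ℝ) 1,
            (∀ j ≤ n, x ≠ Polynomial.Chebyshev.node n j) →
          (|x - ξ| < ε →
            |modelFun α ξ g x - (chebInterpII (modelFun α ξ g) n).eval x|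
              ≤ C * (n : ℝ) ^ (-α)) ∧
          (¬ |x - ξ| < ε →
            |modelFun α ξ g x - (chebInterpII (modelFun α ξ g) n).eval x|
              ≤ C * (n : ℝ) ^ (-α - 1)))) ∧
      ((ξ = 1 ∨ ξ = -1) → (∀ k : ℕ, α ≠ (k : ℝ)) → ∀ ε : ℝ, 0 < ε →
        (∃ C : ℝ, ∀ n : ℕ, 1 ≤ n → ∀ x ∈ Icc (-1 : ℝ) 1, (∀ j ≤ n, x ≠ chebPointI n j) →
          (|x - ξ| < ε →
            |modelFun α ξ g x - (chebInterpI (modelFun α ξ g) n).eval x|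
              ≤ C * (n : ℝ) ^ (-2 * α)) ∧
          (¬ |x - ξ| < ε →
            |modelFun α ξ g x - (chebInterpI (modelFun α ξ g) n).eval x|
              ≤ C * (n : ℝ) ^ (-2 * α - 1))) ∧
        (∃ C : ℝ, ∀ n : ℕ, 1 ≤ n → ∀ x ∈ Icc (-1 : ℝ) 1,
            (∀ j ≤ n, x ≠ Polynomial.Chebyshev.node n j) →
          (|x - ξ| < ε ∧ x ≠ ξ →
            |modelFun α ξ g x - (chebInterpII (modelFun α ξ g) n).eval x|
              ≤ C * (n : ℝ) ^ (-2 * α)) ∧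
          (¬ (|x - ξ| < ε ∧ x ≠ ξ) →
            |modelFun α ξ g x - (chebInterpII (modelFun α ξ g) n).eval x|
              ≤ C * (n : ℝ) ^ (-2 * α - 1)))) := by
  -- Chosen for the endpoint exponent `2α`; it also covers the interior exponent `α`.
  refine ⟨⌈2 * α⌉₊ + 3, fun ξ g hg => ⟨fun hξ _ ε hε => ?_, fun hξ _ ε hε => ?_⟩⟩
  · have hm : α + 3 ≤ ((⌈2 * α⌉₊ + 3 : ℕ) : ℝ) := by
      push_cast; linarith [Nat.le_ceil (2 * α)]
    have h := hasInterpolationOrder_modelFun_interior hα hξ hm hg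
    obtain ⟨C₁, h₁⟩ := h.chebInterpI hε
    obtain ⟨C₂, h₂⟩ := h.chebInterpII hε
    exact ⟨⟨C₁, fun n hn x hx _ => ⟨fun _ => (h₁ n hn x hx).1,
        fun hfar => (h₁ n hn x hx).2 (not_lt.1 hfar)⟩⟩,
      ⟨C₂, fun n hn x hx _ => ⟨fun _ => (h₂ n hn x hx).1,
        fun hfar => (h₂ n hn x hx).2 (not_lt.1 hfar)⟩⟩⟩
  · have hm : 2 * α + 3 ≤ ((⌈2 * α⌉₊ + 3 : ℕ) : ℝ) := by
      push_cast; linarith [Nat.le_ceil (2 * α)]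
    have h : HasInterpolationOrder (modelFun α ξ g) ξ (2 * α) := by
      rcases hξ with rfl | rfl
      · exact hasInterpolationOrder_modelFun_one hα hm hg
      · exact hasInterpolationOrder_modelFun_neg_one hα hm hg
    obtain ⟨C₁, h₁⟩ := h.chebInterpI hε
    obtain ⟨C₂, h₂⟩ := h.chebInterpII hε
    rw [neg_mul]
    refine ⟨⟨C₁, fun n hn x hx _ => ⟨fun _ => (h₁ n hn x hx).1,
        fun hfar => (h₁ n hn x hx).2 (not_lt.1 hfar)⟩⟩,
      ⟨C₂, fun n hn x hx hnode => ⟨fun _ => (h₂ n hn x hx).1,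
        fun hfar => (h₂ n hn x hx).2 ?_⟩⟩⟩
    -- Both endpoints are nodes of the second kind, so the exclusion of nodes already excludes `x =
    -- ξ`, and "otherwise" means `|x - ξ| ≥ ε`.
    have hne : x ≠ ξ := by
      rcases hξ with rfl | rfl
      · rw [← Polynomial.Chebyshev.node_eq_one (n := n)]
        exact hnode 0 (Nat.zero_le n)
      · rw [← Polynomial.Chebyshev.node_eq_neg_one (n := n) (by omega)]
        exact hnode n le_rfl
    exact not_lt.1 fun hlt => hfar ⟨hlt, hne⟩
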